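/- Let $\Gamma\subseteq\mathrm{PSL}_2(\mathbb{R})$ be a cofinite Fuchsian group, i.e. a discrete subgroup such that the quotient $M=\Gamma\backslash\mathbb{H}$ of the upper half-plane has finite area with respect to $\mu_{\mathrm{hyp}}=dx\,dy/y^2$. For an integer $k\ge 1$ let $\mathcal{S}_{2k}^{\Gamma}$ be the complex vector space of cusp forms of weight $2k$ for $\Gamma$, that is, of holomorphic functions $f:\mathbb{H}\to\mathbb{C}$ with $f(\gamma z)=(cz+d)^{2k}f(z)$ for all $\gamma=\left(\begin{smallmatrix}a&b\\c&d\end{smallmatrix}\right)\in\Gamma$ that vanish at all cusps of $\Gamma$, with the Petersson inner product $\langle f_1,f_2\rangle=\int_M f_1(z)\overline{f_2(z)}\,y^{2k}\,\mu_{\mathrm{hyp}}(z)$. This space is finite-dimensional and has an orthonormal basis; for an orthonormal basis $f_1,\dots,f_d$ put $S_k^{\Gamma}(z)=\sum_{j=1}^{d}|f_j(z)|^2\,\mathrm{Im}(z)^{2k}$. Then there is a constant $C>0$, depending only on $\Gamma$, such that for every integer $k\ge 1$ and every orthonormal basis of $\mathcal{S}_{2k}^{\Gamma}$ $$\sup_{z\in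 M}S_k^{\Gamma}(z)\le C\,k^{3/2}.$$ -/

import Mathlib

open MeasureTheory UpperHalfPlane
open scoped MatrixGroups

noncomputable section

namespace FuchsianCusp

/-- The action of `PSL(2, ℝ)` on the upper half-plane by fractional linear transformations. -/
instance instMulActionPSL : MulAction PSL(2, ℝ) ℍ :=
  MulAction.compHom ℍ
    (Matrix.ProjectiveSpecialLinearGroup.toPGL (n := Fin 2) (R := ℝ))

/-- The class of `g ∈ SL(2, ℝ)` acts on `ℍ` by the Möbius transformation of `g`. -/
theorem coe_smul (g : SL(2, ℝ)) (z : ℍ) :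
    (((QuotientGroup.mk g : PSL(2, ℝ)) • z : ℍ) : ℂ)
      = ((g 0 0 : ℂ) * z + (g 0 1 : ℂ)) / ((g 1 0 : ℂ) * z + (g 1 1 : ℂ)) :=
  UpperHalfPlane.coe_specialLinearGroup_apply g z

/-- The full preimage in `SL(2, ℝ)` of a subgroup of `PSL(2, ℝ)`, as a subgroup of `GL(2, ℝ)`. -/
def matrixLift (Γ : Subgroup PSL(2, ℝ)) : Subgroup (GL (Fin 2) ℝ) :=
  (Γ.comap (QuotientGroup.mk' (Subgroup.center SL(2, ℝ)))).map Matrix.SpecialLinearGroup.toGL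

instance (Γ : Subgroup PSL(2, ℝ)) : (matrixLift Γ).HasDetOne :=
  inferInstanceAs (Subgroup.HasDetOne
    ((Γ.comap (QuotientGroup.mk' (Subgroup.center SL(2, ℝ)))).map Matrix.SpecialLinearGroup.toGL))

/-- A cofinite Fuchsian group: a discrete subgroup of `PSL(2, ℝ)` whose quotient `Γ \ ℍ` has finite
hyperbolic area, i.e. which has a fundamental domain of finite area for `dx dy / y ^ 2`
(the `volume` of `ℍ`). -/
structure IsCofiniteFuchsian (Γ : Subgroup PSL(2, ℝ)) : Prop where
  discrete : DiscreteTopology Γ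
  finite_area : ∃ F : Set ℍ, IsFundamentalDomain Γ F (volume : Measure ℍ) ∧ volume F < ⊤

/-- The space of cusp forms of weight `2k` for `Γ`: holomorphic `f : ℍ → ℂ` with
`f (γ z) = (c z + d) ^ (2k) f z` for `γ ∈ Γ`, vanishing at every cusp of `Γ`. -/
abbrev CuspForms (Γ : Subgroup PSL(2, ℝ)) (k : ℕ) : Type :=
  CuspForm (matrixLift Γ) (2 * (k : ℤ))

variable {Γ : Subgroup PSL(2, ℝ)} {k : ℕ}

/-- The Petersson inner product `∫_M f₁ * conj f₂ * y ^ (2k) dμ_hyp`, the integral over `M = Γ \ ℍ`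
being computed on a fundamental domain `F` of `Γ`. -/
def peterssonInner (F : Set ℍ) (f₁ f₂ : CuspForms Γ k) : ℂ :=
  ∫ z in F, f₁ z * (starRingEnd ℂ) (f₂ z) * ((z.im : ℂ) ^ (2 * k)) ∂(volume : Measure ℍ)

/-- Orthonormality with respect to the Petersson inner product. -/
def IsPeterssonOrthonormal {ι : Type} [DecidableEq ι] (F : Set ℍ) (f : ι → CuspForms Γ k) : Prop :=
  ∀ i j, peterssonInner F (f i) (f j) = if i = j then 1 else 0

/-- The sum `∑ j, |f_j z|² (Im z) ^ (2k)`; this is `S_k^Γ(z)` when `f` is an orthonormal basis. -/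
def sumSq {ι : Type} [Fintype ι] (f : ι → CuspForms Γ k) (z : ℍ) : ℝ :=
  ∑ j, ‖f j z‖ ^ 2 * z.im ^ (2 * k)

end FuchsianCusp

end

/-! Write `density k f z = |f z|² y^(2k)` for a cusp form `f`. A mean value inequality on a disc of
hyperbolic radius comparable to `k^(-1/2)` bounds the density at `z` by a constant times `k N`
times the integral of the density over a fundamental domain, where `N` counts the elements of `Γ`
moving `z` by at most `k^(-1/2)`.

To control `N`, call an element of `Γ` shortest at `z` if its conjugate taking `z` to `i` is closest
to `±1`. By the commutator argument of Shimizu, Jørgensen and Margulis, short elements at `z` are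
multiples of a single one up to centre, so finite area forces a compact part, on which `N` is
bounded, and finitely many cusps. In a cusp of width one `N` is at most `4 y k^(-1/2) + 2`, which is
`O(k^(1/2))` up to height `y = 64 k`; above height `k` the maximum principle for `f / q` takes over.
Hence the density is at most `C k^(3/2)` times its integral.

Finally, evaluating this bound on `∑ conj (f_j z) f_j` bounds the sum over an orthonormal family by
the same constant, and integrating over the fundamental domain bounds the length of such a family.
-/

namespace FuchsianCusp

noncomputable section

open scoped Manifold Matrix.Norms.Frobenius commutatorElement

section Matrices

theorem sq_frobenius_norm {m n : Type*} [Fintype m] [Fintype n] (A : Matrix m n ℝ) :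
    ‖A‖ ^ 2 = ∑ i, ∑ j, A i j ^ 2 := by
  rw [Matrix.frobenius_norm_def, ← Real.sqrt_eq_rpow, Real.sq_sqrt (by positivity)]
  simp

theorem sq_frobenius_norm_fin_two (A : Matrix (Fin 2) (Fin 2) ℝ) :
    ‖A‖ ^ 2 = A 0 0 ^ 2 + A 0 1 ^ 2 + (A 1 0 ^ 2 + A 1 1 ^ 2) := by
  simp only [sq_frobenius_norm, Fin.sum_univ_two]

/-- The component of a `2 × 2` matrix in the trace-zero matrices, along the scalar matrices. -/
def tracelessPart (A : Matrix (Fin 2) (Fin 2) ℝ) : Matrix (Fin 2) (Fin 2) ℝ :=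
  A - (A.trace / 2) • 1

theorem sq_norm_tracelessPart (A : Matrix (Fin 2) (Fin 2) ℝ) :
    ‖tracelessPart A‖ ^ 2 = ‖A‖ ^ 2 - A.trace ^ 2 / 2 := by
  simp only [sq_frobenius_norm_fin_two, tracelessPart, Matrix.trace_fin_two, Matrix.sub_apply,
    Matrix.smul_apply, Matrix.one_apply, smul_eq_mul]
  norm_num
  ring

theorem norm_tracelessPart_le_norm_sub_one (A : Matrix (Fin 2) (Fin 2) ℝ) :
    ‖tracelessPart A‖ ≤ ‖A - 1‖ := by
  refine abs_le_of_sq_le_sq' ?_ (norm_nonneg _) |>.2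
  have hA : tracelessPart A = tracelessPart (A - 1) := by
    simp only [tracelessPart, Matrix.trace_sub, Matrix.trace_one, Fintype.card_fin]
    module
  rw [hA, sq_norm_tracelessPart]
  linarith [sq_nonneg (A - 1).trace]

theorem norm_commutator_le (A B : Matrix (Fin 2) (Fin 2) ℝ) :
    ‖A * B - B * A‖ ≤ 2 * ‖tracelessPart A‖ * ‖tracelessPart B‖ := by
  have h : A * B - B * A =
      tracelessPart A * tracelessPart B - tracelessPart B * tracelessPart A := by
    simp only [tracelessPart, mul_sub, sub_mul, mul_smul_comm, smul_mul_assoc, mul_one, one_mul]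
    module
  calc ‖A * B - B * A‖
      ≤ ‖tracelessPart A * tracelessPart B‖ + ‖tracelessPart B * tracelessPart A‖ :=
        h ▸ norm_sub_le _ _
    _ ≤ ‖tracelessPart A‖ * ‖tracelessPart B‖ + ‖tracelessPart B‖ * ‖tracelessPart A‖ :=
        add_le_add (norm_mul_le _ _) (norm_mul_le _ _)
    _ = 2 * ‖tracelessPart A‖ * ‖tracelessPart B‖ := by ring

theorem exists_tracelessPart_eq_smul {A B : Matrix (Fin 2) (Fin 2) ℝ} (hA : tracelessPart A ≠ 0)
    (h : Commute A B) : ∃ β : ℝ, tracelessPart B = β • tracelessPart A := by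
  suffices ∃ β : ℝ, B 0 1 = β * A 0 1 ∧ B 1 0 = β * A 1 0 ∧
      B 0 0 - B 1 1 = β * (A 0 0 - A 1 1) by
    obtain ⟨β, h01, h10, hd⟩ := this
    refine ⟨β, ?_⟩
    ext i j
    fin_cases i <;> fin_cases j <;>
      simp [tracelessPart, Matrix.trace_fin_two, h01, h10] <;> linarith
  have entry (i j : Fin 2) : A i 0 * B 0 j + A i 1 * B 1 j = B i 0 * A 0 j + B i 1 * A 1 j := by
    simpa [Matrix.mul_apply] using congr_fun₂ h i j
  have h00 := entry 0 0
  have h01 := entry 0 1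
  have h10 := entry 1 0
  by_cases hb : A 0 1 = 0
  · by_cases hc : A 1 0 = 0
    · have hd : A 0 0 - A 1 1 ≠ 0 := by
        contrapose! hA
        ext i j
        fin_cases i <;> fin_cases j <;>
          simp [tracelessPart, Matrix.trace_fin_two, hb, hc] <;> linarith
      rw [hb] at h01 ⊢
      rw [hc] at h10 ⊢
      refine ⟨(B 0 0 - B 1 1) / (A 0 0 - A 1 1), ?_, ?_, by field_simp⟩
      · simpa [hd] using show (A 0 0 - A 1 1) * B 0 1 = 0 by linarith
      · simpa [hd] using show (A 0 0 - A 1 1) * B 1 0 = 0 by linarith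
    · refine ⟨B 1 0 / A 1 0, ?_, ?_, ?_⟩ <;> field_simp <;> linarith
  · refine ⟨B 0 1 / A 0 1, ?_, ?_, ?_⟩ <;> field_simp <;> linarith

theorem tracelessPart_eq_zero_iff {g : SL(2, ℝ)} :
    tracelessPart g.val = 0 ↔ g ∈ Subgroup.center SL(2, ℝ) := by
  rw [Matrix.SpecialLinearGroup.mem_center_iff, tracelessPart, sub_eq_zero]
  constructor
  · intro h
    refine ⟨g.val.trace / 2, ?_, by rw [Matrix.scalar_apply, ← Matrix.smul_one_eq_diagonal, ← h]⟩
    simpa [← h] using (Matrix.det_smul (1 : Matrix (Fin 2) (Fin 2) ℝ) (g.val.trace / 2)).symm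
  · rintro ⟨r, -, hr⟩
    rw [← hr, Matrix.trace_fin_two, Matrix.scalar_apply, Matrix.smul_one_eq_diagonal]
    simp

theorem trace_conj (g h : SL(2, ℝ)) : (h⁻¹ * g * h).val.trace = g.val.trace := by
  rw [mul_assoc, Matrix.SpecialLinearGroup.coe_mul, Matrix.trace_mul_comm,
    ← Matrix.SpecialLinearGroup.coe_mul, mul_inv_cancel_right]

theorem tracelessPart_conj (g h : SL(2, ℝ)) :
    tracelessPart (h⁻¹ * g * h).val = h⁻¹.val * tracelessPart g.val * h.val := by
  have hinv : h⁻¹.val * h.val = 1 := by rw [← Matrix.SpecialLinearGroup.coe_mul]; simp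
  rw [tracelessPart, trace_conj, tracelessPart, mul_sub, sub_mul, mul_smul_comm, mul_one,
    smul_mul_assoc, hinv, Matrix.SpecialLinearGroup.coe_mul, Matrix.SpecialLinearGroup.coe_mul]

end Matrices

section Deviation

/-- The quadratic polynomial whose zeros are the fixed points of the Möbius transformation `g`. -/
def fixedPointForm (g : SL(2, ℝ)) (z : ℂ) : ℂ :=
  g 1 0 * z ^ 2 + (g 1 1 - g 0 0) * z - g 0 1

/-- The squared Frobenius norm of the traceless part of any conjugate `h⁻¹ * g * h` with
`h • I = z`, see `deviation_smul_I`: it measures how far `g` is from `±1`, as seen from `z`. -/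
def deviation (g : SL(2, ℝ)) (z : ℍ) : ℝ :=
  2 * Real.cosh (dist z (g • z)) - g.val.trace ^ 2 / 2

theorem exists_smul_I_eq (z : ℍ) : ∃ h : SL(2, ℝ), h • I = z := ⟨_, toSL2R_smul_I z⟩

theorem det_eq_one (g : SL(2, ℝ)) : g 0 0 * g 1 1 - g 0 1 * g 1 0 = 1 := by
  simpa only [Matrix.det_fin_two] using g.det_coe

theorem cosh_dist_smul (g : SL(2, ℝ)) (z : ℍ) :
    Real.cosh (dist z (g • z)) = 1 + ‖fixedPointForm g z‖ ^ 2 / (2 * z.im ^ 2) := by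
  have hd : (g 1 0 : ℂ) * z + g 1 1 ≠ 0 := denom_ne_zero (g : GL (Fin 2) ℝ) z
  have him : (g • z).im = z.im / Complex.normSq ((g 1 0 : ℂ) * z + g 1 1) := by
    rw [MulAction.compHom_smul_def, im_smul_eq_div_normSq]
    simp [denom]
  have hsub : (z : ℂ) - ((g • z : ℍ) : ℂ) = fixedPointForm g z / ((g 1 0 : ℂ) * z + g 1 1) := by
    have hgz : ((g • z : ℍ) : ℂ) = (g 0 0 * z + g 0 1) / (g 1 0 * z + g 1 1) :=
      coe_specialLinearGroup_apply g z
    rw [hgz, fixedPointForm, eq_div_iff hd, sub_mul, div_mul_cancel₀ _ hd]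
    ring
  have hn := Complex.normSq_pos.mpr hd
  rw [UpperHalfPlane.cosh_dist, him, Complex.dist_eq, hsub, norm_div, div_pow,
    ← Complex.normSq_eq_norm_sq ((g 1 0 : ℂ) * z + g 1 1)]
  field_simp [z.im_pos.ne']

theorem deviation_eq (g : SL(2, ℝ)) (z : ℍ) :
    deviation g z = 2 + ‖fixedPointForm g z‖ ^ 2 / z.im ^ 2 - g.val.trace ^ 2 / 2 := by
  rw [deviation, cosh_dist_smul]
  field_simp

theorem sq_norm_eq_two_mul_cosh_dist (g : SL(2, ℝ)) :
    ‖g.val‖ ^ 2 = 2 * Real.cosh (dist I (g • I)) := by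
  rw [sq_frobenius_norm_fin_two, cosh_dist_smul, fixedPointForm, Complex.sq_norm,
    Complex.normSq_apply]
  simp
  linear_combination 2 * det_eq_one g

theorem norm_inv (g : SL(2, ℝ)) : ‖(g⁻¹).val‖ = ‖g.val‖ := by
  rw [← sq_eq_sq₀ (norm_nonneg _) (norm_nonneg _), sq_norm_eq_two_mul_cosh_dist,
    sq_norm_eq_two_mul_cosh_dist, ← dist_smul g I (g⁻¹ • I), smul_inv_smul, dist_comm]

theorem deviation_I (g : SL(2, ℝ)) : deviation g I = ‖tracelessPart g.val‖ ^ 2 := by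
  rw [deviation, sq_norm_tracelessPart, sq_norm_eq_two_mul_cosh_dist]

theorem dist_smul_smul (g h : SL(2, ℝ)) (z : ℍ) :
    dist (h • z) (g • h • z) = dist z ((h⁻¹ * g * h) • z) := by
  rw [← dist_smul h z, smul_smul, smul_smul, mul_assoc, mul_inv_cancel_left]

theorem deviation_smul (g h : SL(2, ℝ)) (z : ℍ) :
    deviation g (h • z) = deviation (h⁻¹ * g * h) z := by
  rw [deviation, deviation, dist_smul_smul, trace_conj]

theorem deviation_conj (g h : SL(2, ℝ)) (z : ℍ) :
    deviation (h * g * h⁻¹) (h • z) = deviation g z := by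
  rw [deviation_smul]
  group

theorem deviation_smul_I (g h : SL(2, ℝ)) :
    deviation g (h • I) = ‖tracelessPart (h⁻¹ * g * h).val‖ ^ 2 := by
  rw [deviation_smul, deviation_I]

theorem deviation_nonneg (g : SL(2, ℝ)) (z : ℍ) : 0 ≤ deviation g z := by
  obtain ⟨h, rfl⟩ := exists_smul_I_eq z
  rw [deviation_smul_I]
  positivity

theorem conj_mem_center_iff {G : Type*} [Group G] {g h : G} :
    h⁻¹ * g * h ∈ Subgroup.center G ↔ g ∈ Subgroup.center G := by
  rw [(inferInstance : (Subgroup.center G).Normal).mem_comm_iff, mul_inv_cancel_left]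

theorem deviation_eq_zero_iff {g : SL(2, ℝ)} {z : ℍ} :
    deviation g z = 0 ↔ g ∈ Subgroup.center SL(2, ℝ) := by
  obtain ⟨h, rfl⟩ := exists_smul_I_eq z
  rw [deviation_smul_I, sq_eq_zero_iff, norm_eq_zero, tracelessPart_eq_zero_iff,
    conj_mem_center_iff]

theorem deviation_pos {g : SL(2, ℝ)} (hg : g ∉ Subgroup.center SL(2, ℝ)) (z : ℍ) :
    0 < deviation g z :=
  (deviation_nonneg g z).lt_of_ne' (deviation_eq_zero_iff.not.mpr hg)

theorem continuous_deviation (g : SL(2, ℝ)) : Continuous (deviation g) := by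
  have : Continuous fun z : ℍ ↦ g • z := continuous_const_smul g
  unfold deviation
  fun_prop

theorem abs_two_sub_sq_trace_le_deviation (g : SL(2, ℝ)) (z : ℍ) :
    |2 - g.val.trace ^ 2 / 2| ≤ deviation g z := by
  obtain ⟨h, rfl⟩ := exists_smul_I_eq z
  rw [deviation_smul_I, ← trace_conj g h]
  generalize h⁻¹ * g * h = m
  have hdet := det_eq_one m
  rw [sq_norm_tracelessPart, sq_frobenius_norm_fin_two, Matrix.trace_fin_two, abs_le]
  constructor <;>
    nlinarith [sq_nonneg (m 0 1 + m 1 0), sq_nonneg (m 0 1 - m 1 0), sq_nonneg (m 0 0 - m 1 1)]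

theorem cosh_dist_le (g : SL(2, ℝ)) (z : ℍ) :
    Real.cosh (dist z (g • z)) ≤ 1 + deviation g z := by
  have := (abs_le.mp (abs_two_sub_sq_trace_le_deviation g z)).1
  rw [deviation] at *
  linarith

end Deviation

section Commutators

theorem sq_norm_le (g : SL(2, ℝ)) : ‖g.val‖ ^ 2 ≤ 2 * (1 + deviation g I) := by
  rw [sq_norm_eq_two_mul_cosh_dist]
  exact mul_le_mul_of_nonneg_left (cosh_dist_le g I) two_pos.le

theorem deviation_I_le_sq_norm_sub_one (g : SL(2, ℝ)) : deviation g I ≤ ‖g.val - 1‖ ^ 2 := by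
  rw [deviation_I]
  gcongr
  exact norm_tracelessPart_le_norm_sub_one _

theorem deviation_inv_mul_I_le (g h : SL(2, ℝ)) :
    deviation (g⁻¹ * h) I ≤ (‖g.val‖ * ‖h.val - g.val‖) ^ 2 := by
  refine (deviation_I_le_sq_norm_sub_one _).trans ?_
  have hfactor : (g⁻¹ * h).val - 1 = (g⁻¹).val * (h.val - g.val) := by
    rw [mul_sub, ← Matrix.SpecialLinearGroup.coe_mul, ← Matrix.SpecialLinearGroup.coe_mul,
      inv_mul_cancel, Matrix.SpecialLinearGroup.coe_one]
  rw [hfactor, ← norm_inv g]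
  gcongr
  exact norm_mul_le _ _

theorem deviation_commutator_I_le (g h : SL(2, ℝ)) : deviation ⁅g, h⁆ I ≤
    4 * deviation g I * deviation h I * (2 * (1 + deviation g I) * (2 * (1 + deviation h I))) := by
  have hfactor : ⁅g, h⁆.val - 1 = (g.val * h.val - h.val * g.val) * ((g⁻¹).val * (h⁻¹).val) := by
    simp only [sub_mul, ← Matrix.SpecialLinearGroup.coe_mul]
    rw [show h * g * (g⁻¹ * h⁻¹) = 1 by group, commutatorElement_def, ← mul_assoc,
      Matrix.SpecialLinearGroup.coe_one]
  calc deviation ⁅g, h⁆ I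
      ≤ ‖(g.val * h.val - h.val * g.val) * ((g⁻¹).val * (h⁻¹).val)‖ ^ 2 :=
        hfactor ▸ deviation_I_le_sq_norm_sub_one _
    _ ≤ (‖g.val * h.val - h.val * g.val‖ * (‖(g⁻¹).val‖ * ‖(h⁻¹).val‖)) ^ 2 := by
        gcongr
        exact (norm_mul_le _ _).trans (by gcongr; exact norm_mul_le _ _)
    _ ≤ (2 * ‖tracelessPart g.val‖ * ‖tracelessPart h.val‖ * (‖g.val‖ * ‖h.val‖)) ^ 2 := by
        rw [norm_inv, norm_inv]
        gcongr
        exact norm_commutator_le _ _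
    _ = 4 * deviation g I * deviation h I * (‖g.val‖ ^ 2 * ‖h.val‖ ^ 2) := by
        rw [deviation_I, deviation_I]
        ring
    _ ≤ _ := by
        have := deviation_nonneg g I
        have := deviation_nonneg h I
        gcongr <;> exact sq_norm_le _

theorem deviation_commutator_le (g h : SL(2, ℝ)) (z : ℍ) : deviation ⁅g, h⁆ z ≤
    4 * deviation g z * deviation h z * (2 * (1 + deviation g z) * (2 * (1 + deviation h z))) := by
  obtain ⟨k, rfl⟩ := exists_smul_I_eq z
  have hconj : k⁻¹ * ⁅g, h⁆ * k = ⁅k⁻¹ * g * k, k⁻¹ * h * k⁆ := by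
    simp only [commutatorElement_def]
    group
  simpa only [deviation_smul, hconj] using
    deviation_commutator_I_le (k⁻¹ * g * k) (k⁻¹ * h * k)

theorem deviation_commutator_lt {g h : SL(2, ℝ)} {z : ℍ} (hg : 0 < deviation g z)
    (hg' : deviation g z ≤ 1 / 64) (hh : deviation h z ≤ 1 / 64) :
    deviation ⁅g, h⁆ z < deviation g z := by
  have := deviation_nonneg h z
  calc deviation ⁅g, h⁆ z
      ≤ 4 * deviation g z * deviation h z *
          (2 * (1 + deviation g z) * (2 * (1 + deviation h z))) := deviation_commutator_le g h z
    _ ≤ 4 * deviation g z * (1 / 64) * (2 * (1 + 1 / 64) * (2 * (1 + 1 / 64))) := by gcongr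
    _ < deviation g z := by linarith

theorem commute_of_commutator_mem_center {g h : SL(2, ℝ)} {z : ℍ} (hg : deviation g z < 2)
    (hc : ⁅g, h⁆ ∈ Subgroup.center SL(2, ℝ)) : Commute g h := by
  obtain ⟨r, hr, hscalar⟩ := Matrix.SpecialLinearGroup.mem_center_iff.mp hc
  have hconj : ⁅g, h⁆ * (h⁻¹⁻¹ * g * h⁻¹) = g := by
    rw [commutatorElement_def]
    group
  have htr : g.val.trace = r * g.val.trace := by
    conv_lhs => rw [← hconj]
    rw [Matrix.SpecialLinearGroup.coe_mul, ← hscalar, Matrix.scalar_apply,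
      ← Matrix.smul_one_eq_diagonal, smul_mul_assoc, one_mul, Matrix.trace_smul, trace_conj,
      smul_eq_mul]
  have htr0 : g.val.trace ≠ 0 := by
    intro h0
    have := Real.one_le_cosh (dist z (g • z))
    rw [deviation, h0] at hg
    linarith
  have hr1 : r = 1 := by simpa [htr0] using htr.symm
  rw [← commutatorElement_eq_one_iff_commute]
  ext1
  simpa [hr1] using congr_fun₂ hscalar.symm _ _

theorem deviation_eq_sq_mul {g h : SL(2, ℝ)} {β : ℝ}
    (hβ : tracelessPart h.val = β • tracelessPart g.val) (z : ℍ) :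
    deviation h z = β ^ 2 * deviation g z := by
  obtain ⟨k, rfl⟩ := exists_smul_I_eq z
  rw [deviation_smul_I, deviation_smul_I, tracelessPart_conj, hβ, Matrix.mul_smul, Matrix.smul_mul,
    norm_smul, mul_pow, Real.norm_eq_abs, sq_abs, tracelessPart_conj]

theorem exists_fixedPointForm_ne_zero {g : SL(2, ℝ)} (hg : g ∉ Subgroup.center SL(2, ℝ)) :
    ∃ x : ℝ, fixedPointForm g x ≠ 0 := by
  contrapose! hg
  have h (x : ℝ) : g 1 0 * x ^ 2 + (g 1 1 - g 0 0) * x - g 0 1 = 0 := by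
    have := hg x
    rw [fixedPointForm] at this
    exact_mod_cast this
  have h0 := h 0
  have h1 := h 1
  have h2 := h (-1)
  rw [← tracelessPart_eq_zero_iff]
  ext i j
  fin_cases i <;> fin_cases j <;> simp [tracelessPart, Matrix.trace_fin_two] <;> linarith

theorem exists_le_deviation {g : SL(2, ℝ)} (hg : g ∉ Subgroup.center SL(2, ℝ)) (B : ℝ) :
    ∃ z : ℍ, B ≤ deviation g z := by
  obtain ⟨x, hx⟩ := exists_fixedPointForm_ne_zero hg
  have hnum : Filter.Tendsto (fun y : ℝ ↦ ‖fixedPointForm g (x + y * Complex.I)‖ ^ 2)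
      (nhdsWithin 0 (Set.Ioi 0)) (nhds (‖fixedPointForm g x‖ ^ 2)) := by
    have : Continuous fun y : ℝ ↦ ‖fixedPointForm g (x + y * Complex.I)‖ ^ 2 := by
      unfold fixedPointForm
      fun_prop
    simpa using (this.tendsto 0).mono_left nhdsWithin_le_nhds
  have hlim : Filter.Tendsto (fun y : ℝ ↦ ‖fixedPointForm g (x + y * Complex.I)‖ ^ 2 * y⁻¹ ^ 2)
      (nhdsWithin 0 (Set.Ioi 0)) Filter.atTop :=
    hnum.pos_mul_atTop (by positivity)
      ((Filter.tendsto_pow_atTop two_ne_zero).comp tendsto_inv_nhdsGT_zero)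
  obtain ⟨y, hy, hy0 : 0 < y⟩ :=
    ((hlim.eventually_ge_atTop (B - 2 + g.val.trace ^ 2 / 2)).and self_mem_nhdsWithin).exists
  refine ⟨⟨x + y * Complex.I, by simpa using hy0⟩, ?_⟩
  rw [deviation_eq]
  simp only [UpperHalfPlane.im, Complex.add_im, Complex.ofReal_im, Complex.mul_im,
    Complex.ofReal_re, Complex.I_im, Complex.I_re]
  rw [inv_pow, ← div_eq_mul_inv] at hy
  ring_nf at hy ⊢
  linarith

end Commutators

section Packing

theorem packingNumber_ne_top {X : Type*} [PseudoEMetricSpace X] {s : Set X}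
    (hs : TotallyBounded s) {ε : NNReal} (hε : ε ≠ 0) : Metric.packingNumber ε s ≠ ⊤ := by
  obtain ⟨t, -, ht, hcov⟩ :=
    Metric.exists_finite_isCover_of_totallyBounded (ε := ε / 2) (by positivity) hs
  refine ne_top_of_le_ne_top ht.encard_lt_top.ne ?_
  calc Metric.packingNumber ε s = Metric.packingNumber (2 * (ε / 2)) s := by
        rw [mul_div_cancel₀ ε two_ne_zero]
    _ ≤ Metric.externalCoveringNumber (ε / 2) s :=
        Metric.packingNumber_two_mul_le_externalCoveringNumber _ _
    _ ≤ t.encard := iInf₂_le t hcov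

theorem exists_card_le_of_norm_le {c : ℝ} (hc : 0 < c) {B : ℝ} (hB : 0 < B) :
    ∃ M : ℕ, ∀ s : Finset SL(2, ℝ), (∀ g ∈ s, ‖g.val‖ ≤ B) →
      (∀ g ∈ s, ∀ h ∈ s, g ≠ h → c ≤ deviation (g⁻¹ * h) I) → s.card ≤ M := by
  have : ProperSpace (Matrix (Fin 2) (Fin 2) ℝ) := FiniteDimensional.proper ℝ _
  set δ : ℝ := √c / (2 * B) with hδ
  have hδ0 : 0 < δ := by positivity
  obtain ⟨M, hM⟩ := ENat.ne_top_iff_exists.mp (packingNumber_ne_top (ε := δ.toNNReal)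
    (isCompact_closedBall (0 : Matrix (Fin 2) (Fin 2) ℝ) B).totallyBounded (by simpa using hδ0))
  refine ⟨M, fun s hs hsep ↦ ?_⟩
  have hsub : (fun g : SL(2, ℝ) ↦ g.val) '' s ⊆ Metric.closedBall 0 B := by
    rintro _ ⟨g, hg, rfl⟩
    simpa using hs g hg
  have hdist : Metric.IsSeparated δ.toNNReal ((fun g : SL(2, ℝ) ↦ g.val) '' s) := by
    rintro _ ⟨g, hg, rfl⟩ _ ⟨h, hh, rfl⟩ hne
    have hlt : δ < ‖h.val - g.val‖ := by
      by_contra! hle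
      refine (hsep g hg h hh (ne_of_apply_ne _ hne)).not_gt ?_
      calc deviation (g⁻¹ * h) I ≤ (‖g.val‖ * ‖h.val - g.val‖) ^ 2 := deviation_inv_mul_I_le g h
        _ ≤ (B * δ) ^ 2 := by gcongr; exact hs g hg
        _ = c / 4 := by rw [hδ]; field_simp; rw [Real.sq_sqrt hc.le]; ring
        _ < c := by linarith
    rw [edist_comm, edist_eq_enorm_sub, ← ofReal_norm]
    exact (ENNReal.ofReal_lt_ofReal_iff (hδ0.trans hlt)).mpr hlt
  have hcard := hdist.encard_le_packingNumber hsub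
  have hinj : Function.Injective fun g : SL(2, ℝ) ↦ g.val := fun _ _ ↦ Subtype.ext
  rw [hinj.encard_image, Set.encard_coe_eq_coe_finsetCard] at hcard
  exact ENat.natCast_le_natCast.mp (hcard.trans_eq hM.symm)

theorem exists_card_le_of_separated {c : ℝ} (hc : 0 < c) (R : ℝ) :
    ∃ M : ℕ, ∀ (z : ℍ) (s : Finset SL(2, ℝ)), (∀ g ∈ s, dist z (g • z) ≤ R) →
      (∀ g ∈ s, ∀ h ∈ s, g ≠ h → c ≤ deviation (g⁻¹ * h) z) → s.card ≤ M := by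
  obtain ⟨M, hM⟩ := exists_card_le_of_norm_le hc (B := √(2 * Real.cosh R)) (by positivity)
  refine ⟨M, fun z s hs hsep ↦ ?_⟩
  obtain ⟨k, rfl⟩ := exists_smul_I_eq z
  have hinj : Function.Injective (k⁻¹ * · * k) := fun g h hgh ↦ by simpa using hgh
  rw [← Finset.card_image_of_injective s hinj]
  refine hM _ (Finset.forall_mem_image.mpr fun g hg ↦ ?_)
    (Finset.forall_mem_image.mpr fun g hg ↦ Finset.forall_mem_image.mpr fun h hh hne ↦ ?_)
  · refine Real.le_sqrt_of_sq_le ?_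
    rw [sq_norm_eq_two_mul_cosh_dist, ← dist_smul_smul]
    gcongr
    exact Real.cosh_le_cosh.mpr (abs_le_abs_of_nonneg dist_nonneg (hs g hg))
  · have := hsep g hg h hh (ne_of_apply_ne (k⁻¹ * · * k) hne)
    rw [deviation_smul] at this
    convert this using 2
    group

end Packing

section ShortestElements

open scoped Pointwise

/-- `g` is a non-central element of `G` of least deviation at `z`. -/
structure IsShortest (G : Subgroup SL(2, ℝ)) (g : SL(2, ℝ)) (z : ℍ) : Prop where
  mem : g ∈ G
  notMem_center : g ∉ Subgroup.center SL(2, ℝ)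
  le : ∀ h ∈ G, h ∉ Subgroup.center SL(2, ℝ) → deviation g z ≤ deviation h z

variable {G : Subgroup SL(2, ℝ)} {g h : SL(2, ℝ)} {z w : ℍ}

theorem finite_smul_mem [DiscreteTopology G] {K L : Set ℍ} (hK : IsCompact K)
    (hL : IsCompact L) : {g | g ∈ G ∧ ∃ z ∈ K, g • z ∈ L}.Finite := by
  have h := ProperlyDiscontinuousSMul.finite_disjoint_inter_image (Γ := G) hK hL
  refine (h.image ((↑) : G → SL(2, ℝ))).subset ?_
  rintro g ⟨hg, z, hz, hgz⟩
  exact ⟨⟨g, hg⟩, ⟨_, ⟨z, hz, rfl⟩, hgz⟩, rfl⟩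

theorem finite_dist_le [DiscreteTopology G] {K : Set ℍ} (hK : IsCompact K) (R : ℝ) :
    {g | g ∈ G ∧ ∃ z ∈ K, dist z (g • z) ≤ R}.Finite := by
  refine (finite_smul_mem (G := G) hK (hK.cthickening (r := R))).subset ?_
  rintro g ⟨hg, z, hz, hgz⟩
  exact ⟨hg, z, hz, Metric.mem_cthickening_of_dist_le _ z _ _ hz (dist_comm z _ ▸ hgz)⟩

theorem finite_deviation_le [DiscreteTopology G] {K : Set ℍ} (hK : IsCompact K) (B : ℝ) :
    {g | g ∈ G ∧ ∃ z ∈ K, deviation g z ≤ B}.Finite := by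
  refine (finite_dist_le (G := G) hK (2 * (1 + B))).subset ?_
  rintro g ⟨hg, z, hz, hgz⟩
  refine ⟨hg, z, hz, ?_⟩
  have hcosh := cosh_dist_le g z
  have hexp := Real.add_one_le_exp (dist z (g • z))
  have := Real.exp_pos (-dist z (g • z))
  rw [Real.cosh_eq] at hcosh
  linarith

theorem exists_isShortest [DiscreteTopology G] (hh : h ∈ G) (hc : h ∉ Subgroup.center SL(2, ℝ))
    (z : ℍ) : ∃ g, IsShortest G g z := by
  have hfin : {g | g ∈ G ∧ g ∉ Subgroup.center SL(2, ℝ) ∧ deviation g z ≤ deviation h z}.Finite :=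
    (finite_deviation_le (G := G) (isCompact_singleton (x := z)) (deviation h z)).subset
      fun g hg ↦ ⟨hg.1, z, rfl, hg.2.2⟩
  obtain ⟨g, ⟨hgG, hgc, hgh⟩, hmin⟩ := Set.exists_min_image _ (deviation · z) hfin
    ⟨h, hh, hc, le_rfl⟩
  refine ⟨g, hgG, hgc, fun k hk hkc ↦ ?_⟩
  rcases le_total (deviation k z) (deviation h z) with hle | hle
  · exact hmin k ⟨hk, hkc, hle⟩
  · exact hgh.trans hle

theorem IsShortest.commute (hg : IsShortest G g z) (hgz : deviation g z ≤ 1 / 64) (hh : h ∈ G)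
    (hhz : deviation h z ≤ 1 / 64) : Commute g h := by
  refine commute_of_commutator_mem_center (z := z) (by linarith) ?_
  by_contra hc
  have hmem : ⁅g, h⁆ ∈ G :=
    G.mul_mem (G.mul_mem (G.mul_mem hg.mem hh) (G.inv_mem hg.mem)) (G.inv_mem hh)
  exact (deviation_commutator_lt (deviation_pos hg.notMem_center z) hgz hhz).not_ge
    (hg.le _ hmem hc)

theorem IsShortest.exists_tracelessPart_eq_smul (hg : IsShortest G g z)
    (hgz : deviation g z ≤ 1 / 64) (hh : h ∈ G) (hhz : deviation h z ≤ 1 / 64) :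
    ∃ β : ℝ, tracelessPart h.val = β • tracelessPart g.val :=
  FuchsianCusp.exists_tracelessPart_eq_smul
    (tracelessPart_eq_zero_iff.not.mpr hg.notMem_center)
    (congrArg Subtype.val (hg.commute hgz hh hhz).eq)

theorem IsShortest.of_deviation_le [DiscreteTopology G] (hg : IsShortest G g z)
    (hw : deviation g w ≤ 1 / 64) : IsShortest G g w := by
  obtain ⟨k, hk⟩ := exists_isShortest hg.mem hg.notMem_center w
  have hkg : deviation k w ≤ deviation g w := hk.le g hg.mem hg.notMem_center
  obtain ⟨β, hβ⟩ := hk.exists_tracelessPart_eq_smul (hkg.trans hw) hg.mem hw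
  have hβ1 : β ^ 2 ≤ 1 := by
    have := hg.le k hk.mem hk.notMem_center
    rwa [deviation_eq_sq_mul hβ, mul_le_iff_le_one_left (deviation_pos hk.notMem_center z)] at this
  refine ⟨hg.mem, hg.notMem_center, fun h hh hc ↦ le_trans ?_ (hk.le h hh hc)⟩
  rw [deviation_eq_sq_mul hβ]
  exact mul_le_of_le_one_left (deviation_nonneg k w) hβ1

theorem IsShortest.conj_smul (hg : IsShortest G g z) (h : SL(2, ℝ)) :
    IsShortest (MulAut.conj h • G) (h * g * h⁻¹) (h • z) := by
  refine ⟨?_, ?_, fun k hk hkc ↦ ?_⟩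
  · simpa using Subgroup.smul_mem_pointwise_smul g (MulAut.conj h) G hg.mem
  · simpa using (conj_mem_center_iff (h := h⁻¹)).not.mpr hg.notMem_center
  · rw [deviation_conj, deviation_smul]
    refine hg.le _ ?_ (conj_mem_center_iff.not.mpr hkc)
    simpa [Subgroup.mem_pointwise_smul_iff_inv_smul_mem, ← map_inv] using hk

theorem IsShortest.conj_mem (hg : IsShortest G g z) (hh : h ∈ G) :
    IsShortest G (h * g * h⁻¹) (h • z) := by
  simpa only [Subgroup.conj_smul_eq_self_of_mem hh] using hg.conj_smul h

theorem IsShortest.exists_deviation_eq [DiscreteTopology G] (hg : IsShortest G g z)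
    (hz : deviation g z ≤ 1 / 64) : ∃ w, IsShortest G g w ∧ deviation g w = 1 / 64 := by
  obtain ⟨z', hz'⟩ := exists_le_deviation hg.notMem_center (1 / 64)
  obtain ⟨w, hw⟩ :=
    mem_range_of_exists_le_of_exists_ge (continuous_deviation g) ⟨z, hz⟩ ⟨z', hz'⟩
  exact ⟨w, hg.of_deviation_le hw.le, hw⟩

theorem exists_le_abs_of_finite {α : Type*} {E : Set α} (hE : E.Finite) (f : α → ℝ) {c : ℝ}
    (hc : 0 < c) : ∃ x, 0 < x ∧ x ≤ c ∧ ∀ a ∈ E, f a ≠ 0 → x ≤ |f a| := by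
  have hf : ∀ᶠ x : ℝ in nhdsWithin 0 (Set.Ioi 0), ∀ a ∈ E, f a ≠ 0 → x ≤ |f a| := by
    refine (Filter.eventually_all_finite hE).mpr fun a _ ↦ ?_
    by_cases ha : f a = 0
    · simp [ha]
    · filter_upwards [nhdsWithin_le_nhds (eventually_le_nhds (abs_pos.mpr ha))] with x hx _ using hx
  obtain ⟨x, ⟨hxf, hxc⟩, hx0⟩ :=
    ((hf.and (nhdsWithin_le_nhds (eventually_le_nhds hc))).and self_mem_nhdsWithin).exists
  exact ⟨x, hx0, hxc, hxf⟩

/-- The points at which every non-central element of `G` has deviation at least `c`. -/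
def thickPart (G : Subgroup SL(2, ℝ)) (c : ℝ) : Set ℍ :=
  {z | ∀ g ∈ G, g ∉ Subgroup.center SL(2, ℝ) → c ≤ deviation g z}

theorem IsShortest.exists_conj_mem_finite [DiscreteTopology G] {K : Set ℍ}
    (hthick : ∀ w ∈ thickPart G (1 / 64), ∃ h ∈ G, h • w ∈ K) (hg : IsShortest G g z)
    (hz : deviation g z ≤ 1 / 64) :
    ∃ h ∈ G, h * g * h⁻¹ ∈ {g | g ∈ G ∧ ∃ z ∈ K, deviation g z ≤ 1 / 64} := by
  obtain ⟨w, hw, hgw⟩ := hg.exists_deviation_eq hz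
  obtain ⟨h, hh, hhw⟩ := hthick w fun k hk hkc ↦ hgw ▸ hw.le k hk hkc
  exact ⟨h, hh, (hw.conj_mem hh).mem, h • w, hhw, by rw [deviation_conj, hgw]⟩

theorem exists_compact_and_parabolics [DiscreteTopology G]
    (hthick : ∀ c : ℝ, 0 < c → ∃ K : Set ℍ, IsCompact K ∧ ∀ w ∈ thickPart G c, ∃ h ∈ G, h • w ∈ K)
    {c : ℝ} (hc : 0 < c) (hc' : c ≤ 1 / 64) :
    ∃ (K : Set ℍ) (P : Set SL(2, ℝ)), IsCompact K ∧ P.Finite ∧ (∀ g ∈ P, g.val.trace ^ 2 = 4) ∧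
      ∀ z, ∃ h ∈ G, h • z ∈ K ∨ ∃ g ∈ P, IsShortest G g (h • z) ∧ deviation g (h • z) < c := by
  obtain ⟨K₀, hK₀, hthick₀⟩ := hthick (1 / 64) (by norm_num)
  have hE := finite_deviation_le (G := G) hK₀ (1 / 64)
  set E := {g | g ∈ G ∧ ∃ z ∈ K₀, deviation g z ≤ 1 / 64}
  obtain ⟨c₁, hc₁, hc₁c, hc₁E⟩ := exists_le_abs_of_finite hE (fun g ↦ 2 - g.val.trace ^ 2 / 2) hc
  obtain ⟨K, hK, hthick₁⟩ := hthick c₁ hc₁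
  refine ⟨K, {g ∈ E | g.val.trace ^ 2 = 4}, hK, hE.subset (Set.sep_subset _ _),
    fun g hg ↦ hg.2, fun z ↦ ?_⟩
  by_cases hz : z ∈ thickPart G c₁
  · obtain ⟨h, hh, hhz⟩ := hthick₁ z hz
    exact ⟨h, hh, Or.inl hhz⟩
  · simp only [thickPart, Set.mem_ofPred_eq, not_forall, not_le] at hz
    obtain ⟨k, hkG, hkc, hkz⟩ := hz
    obtain ⟨g, hg⟩ := exists_isShortest hkG hkc z
    have hgz : deviation g z < c₁ := (hg.le k hkG hkc).trans_lt hkz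
    obtain ⟨h, hh, hhE⟩ := hg.exists_conj_mem_finite hthick₀ (by linarith)
    have hdev : deviation (h * g * h⁻¹) (h • z) < c₁ := by rwa [deviation_conj]
    refine ⟨h, hh, Or.inr ⟨h * g * h⁻¹, ⟨hhE, ?_⟩, hg.conj_mem hh, hdev.trans_le hc₁c⟩⟩
    by_contra htrace
    refine (hc₁E _ hhE fun h0 ↦ htrace (by linarith)).not_gt ?_
    exact (abs_two_sub_sq_trace_le_deviation _ (h • z)).trans_lt hdev

end ShortestElements

section Parabolic

/-- The parabolic matrix of the translation `z ↦ z + 1`. -/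
def translation : SL(2, ℝ) := ⟨!![1, 1; 0, 1], by simp⟩

variable {G : Subgroup SL(2, ℝ)} {g : SL(2, ℝ)} {w z : ℍ}

theorem coe_translation : translation.val = !![1, 1; 0, 1] := rfl

theorem coe_inv (g : SL(2, ℝ)) : (g⁻¹).val = !![g 1 1, -g 0 1; -g 1 0, g 0 0] := by
  rw [Matrix.SpecialLinearGroup.coe_inv, Matrix.adjugate_fin_two]

theorem deviation_of_upper (h10 : g 1 0 = 0) (hdiag : g 0 0 = g 1 1) (z : ℍ) :
    deviation g z = g 0 1 ^ 2 / z.im ^ 2 := by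
  have hdet := det_eq_one g
  rw [h10, hdiag] at hdet
  rw [deviation_eq, fixedPointForm, Matrix.trace_fin_two, h10, hdiag]
  simp
  linear_combination (-2) * hdet

theorem deviation_translation (z : ℍ) : deviation translation z = 1 / z.im ^ 2 := by
  rw [deviation_of_upper] <;> simp [coe_translation]

theorem deviation_neg (g : SL(2, ℝ)) (z : ℍ) : deviation (-g) z = deviation g z := by
  have hform : fixedPointForm (-g) z = -fixedPointForm g z := by
    simp only [fixedPointForm, Matrix.SpecialLinearGroup.coe_neg, Matrix.neg_apply]
    push_cast
    ring
  rw [deviation_eq, deviation_eq, hform, norm_neg, Matrix.SpecialLinearGroup.coe_neg,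
    Matrix.trace_neg, neg_sq]

theorem deviation_inv (g : SL(2, ℝ)) (z : ℍ) : deviation g⁻¹ z = deviation g z := by
  have htrace : g⁻¹.val.trace = g.val.trace := by
    simp only [Matrix.trace_fin_two, coe_inv, Matrix.of_apply, Matrix.cons_val, add_comm]
  rw [deviation, deviation, htrace, ← dist_smul g z (g⁻¹ • z), smul_inv_smul, dist_comm]

theorem exists_conj_eq_zero (ht : g.val.trace ^ 2 = 4) :
    ∃ τ : SL(2, ℝ), (τ⁻¹ * g * τ) 1 0 = 0 := by
  by_cases hc : g 1 0 = 0
  · exact ⟨1, by simpa using hc⟩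
  · obtain ⟨τ, hτ⟩ : ∃ τ : SL(2, ℝ), τ.val = !![(g 0 0 - g 1 1) / (2 * g 1 0), -1; 1, 0] :=
      ⟨⟨_, by simp⟩, rfl⟩
    refine ⟨τ, ?_⟩
    rw [Matrix.trace_fin_two] at ht
    have hdet := det_eq_one g
    simp only [Matrix.SpecialLinearGroup.coe_mul, coe_inv, hτ, Matrix.mul_apply, Fin.sum_univ_two]
    simp
    field_simp
    linarith

theorem exists_conj_translation_eq {u : ℝ} (hu : 0 < u) :
    ∃ σ : SL(2, ℝ), (σ * translation * σ⁻¹).val = !![1, u; 0, 1] := by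
  obtain ⟨σ, hσ⟩ : ∃ σ : SL(2, ℝ), σ.val = !![√u, 0; 0, (√u)⁻¹] :=
    ⟨⟨_, by simp [(Real.sqrt_pos.mpr hu).ne']⟩, rfl⟩
  refine ⟨σ, ?_⟩
  rw [Matrix.SpecialLinearGroup.coe_mul, Matrix.SpecialLinearGroup.coe_mul, coe_inv, hσ,
    coe_translation]
  simp [(Real.sqrt_pos.mpr hu).ne', hu.le]

theorem exists_conj_translation_of_upper (hg : g ∉ Subgroup.center SL(2, ℝ))
    (h10 : g 1 0 = 0) (ht : g.val.trace ^ 2 = 4) :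
    ∃ σ : SL(2, ℝ), σ * translation * σ⁻¹ ∈ ({g, g⁻¹, -g, -g⁻¹} : Set SL(2, ℝ)) := by
  have hdet : g 0 0 * g 1 1 = 1 := by simpa [h10] using det_eq_one g
  rw [Matrix.trace_fin_two] at ht
  have hdiag : g 0 0 = g 1 1 := by
    have : (g 0 0 - g 1 1) ^ 2 = 0 := by linear_combination ht - 4 * hdet
    linarith [pow_eq_zero_iff two_ne_zero |>.mp this]
  have hu : g 0 1 ≠ 0 := by
    contrapose! hg
    rw [← deviation_eq_zero_iff (z := I), deviation_of_upper h10 hdiag, hg]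
    simp
  obtain ⟨σ, hσ⟩ := exists_conj_translation_eq (abs_pos.mpr hu)
  refine ⟨σ, ?_⟩
  generalize σ * translation * σ⁻¹ = m at hσ
  have hg : g.val = !![g 1 1, g 0 1; 0, g 1 1] := by
    have heta := Matrix.eta_fin_two g.val
    rwa [h10, hdiag] at heta
  have hg' : (g⁻¹).val = !![g 1 1, -g 0 1; 0, g 1 1] := by rw [coe_inv, h10, hdiag, neg_zero]
  rcases mul_self_eq_one_iff.mp (hdiag ▸ hdet) with h11 | h11 <;>
    rcases abs_choice (g 0 1) with habs | habs <;> rw [habs] at hσ <;> rw [h11] at hg hg'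
  · exact Or.inl (Subtype.ext (hσ.trans hg.symm))
  · exact Or.inr (Or.inl (Subtype.ext (hσ.trans hg'.symm)))
  · refine Or.inr (Or.inr (Or.inr (Subtype.ext (hσ.trans ?_))))
    rw [Matrix.SpecialLinearGroup.coe_neg, hg']
    simp
  · refine Or.inr (Or.inr (Or.inl (Subtype.ext (hσ.trans ?_))))
    rw [Matrix.SpecialLinearGroup.coe_neg, hg]
    simp

theorem exists_conj_translation (hg : g ∉ Subgroup.center SL(2, ℝ)) (ht : g.val.trace ^ 2 = 4) :
    ∃ σ : SL(2, ℝ), σ * translation * σ⁻¹ ∈ ({g, g⁻¹, -g, -g⁻¹} : Set SL(2, ℝ)) := by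
  obtain ⟨τ, hτ⟩ := exists_conj_eq_zero ht
  obtain ⟨σ, hσ⟩ := exists_conj_translation_of_upper (conj_mem_center_iff.not.mpr hg) hτ
    (by rwa [trace_conj])
  refine ⟨τ * σ, ?_⟩
  have hconj : τ * σ * translation * (τ * σ)⁻¹ = τ * (σ * translation * σ⁻¹) * τ⁻¹ := by group
  rw [hconj]
  rcases hσ with h | h | h | h <;> rw [h] <;> simp [mul_assoc]

theorem exists_conj_translation_mem (hG : -1 ∈ G) (hg : g ∈ G)
    (hgc : g ∉ Subgroup.center SL(2, ℝ)) (ht : g.val.trace ^ 2 = 4) :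
    ∃ σ : SL(2, ℝ), σ * translation * σ⁻¹ ∈ G ∧
      ∀ z, deviation (σ * translation * σ⁻¹) z = deviation g z := by
  obtain ⟨σ, hσ⟩ := exists_conj_translation hgc ht
  have hneg {h : SL(2, ℝ)} (hh : h ∈ G) : -h ∈ G := by simpa using G.mul_mem hG hh
  refine ⟨σ, ?_, fun z ↦ ?_⟩
  · rcases hσ with h | h | h | h <;> rw [h]
    exacts [hg, G.inv_mem hg, hneg hg, hneg (G.inv_mem hg)]
  · rcases hσ with h | h | h | h <;> rw [h] <;> simp only [deviation_neg, deviation_inv]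

theorem inv_mul_of_upper {g h : SL(2, ℝ)} (hg : g 1 0 = 0 ∧ g 0 0 = g 1 1)
    (hh : h 1 0 = 0 ∧ h 0 0 = h 1 1) :
    (g⁻¹ * h) 1 0 = 0 ∧ (g⁻¹ * h) 0 0 = (g⁻¹ * h) 1 1 ∧
      (g⁻¹ * h) 0 1 = g 0 0 * h 0 1 - h 0 0 * g 0 1 := by
  simp only [Matrix.SpecialLinearGroup.coe_mul, coe_inv, Matrix.mul_apply, Fin.sum_univ_two, hg, hh]
  simp
  ring

end Parabolic

section CuspNeighbourhood

variable {G : Subgroup SL(2, ℝ)} {δ : SL(2, ℝ)} {w : ℍ}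

theorem deviation_conj_translation (δ : SL(2, ℝ)) (w : ℍ) :
    deviation (δ * translation * δ⁻¹) w = 1 / (δ⁻¹ • w).im ^ 2 := by
  rw [← deviation_translation, ← deviation_conj translation δ, smul_inv_smul]

theorem deviation_conj_translation_le (hw : 64 ≤ w.im) (hd : dist w (δ⁻¹ • w) ≤ 2) :
    deviation (δ * translation * δ⁻¹) w ≤ 1 / 64 := by
  have hexp : Real.exp (dist w (δ⁻¹ • w)) ≤ 8 := by
    calc Real.exp (dist w (δ⁻¹ • w)) ≤ Real.exp 1 ^ 2 := by
          rw [← Real.exp_nat_mul]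
          exact Real.exp_le_exp.mpr (by simpa using hd)
      _ ≤ 2.8 ^ 2 := by
          gcongr
          linarith [Real.exp_one_lt_d9]
      _ ≤ 8 := by norm_num
  have him : 8 ≤ (δ⁻¹ • w).im := by
    have := (im_le_im_mul_exp_dist w (δ⁻¹ • w)).trans
      (mul_le_mul_of_nonneg_left hexp (δ⁻¹ • w).im_pos.le)
    linarith
  rw [deviation_conj_translation]
  exact one_div_le_one_div_of_le (by norm_num) (by nlinarith)

theorem eq_zero_of_tracelessPart_conj_translation {β : ℝ}
    (h : tracelessPart (δ * translation * δ⁻¹).val = β • tracelessPart translation.val) :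
    δ 1 0 = 0 := by
  have h10 := congr_fun₂ h 1 0
  simp only [tracelessPart, Matrix.SpecialLinearGroup.coe_mul, coe_inv, coe_translation,
    Matrix.sub_apply, Matrix.smul_apply, Matrix.mul_apply, Fin.sum_univ_two] at h10
  simp at h10
  nlinarith

theorem IsShortest.eq_zero_and_im_le (hT : IsShortest G translation w) (hw : 64 ≤ w.im)
    (hδ : δ ∈ G) (hd : dist w (δ⁻¹ • w) ≤ 2) : δ 1 0 = 0 ∧ (δ⁻¹ • w).im ≤ w.im := by
  have hTw : deviation translation w ≤ 1 / 64 := by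
    rw [deviation_translation]
    exact one_div_le_one_div_of_le (by norm_num) (by nlinarith)
  have hmem : δ * translation * δ⁻¹ ∈ G := G.mul_mem (G.mul_mem hδ hT.mem) (G.inv_mem hδ)
  obtain ⟨β, hβ⟩ := hT.exists_tracelessPart_eq_smul hTw hmem (deviation_conj_translation_le hw hd)
  refine ⟨eq_zero_of_tracelessPart_conj_translation hβ, ?_⟩
  have hle := hT.le _ hmem
    (by simpa using (conj_mem_center_iff (h := δ⁻¹)).not.mpr hT.notMem_center)
  rw [deviation_translation, deviation_conj_translation] at hle
  rwa [one_div_le_one_div (pow_pos w.im_pos 2) (pow_pos (δ⁻¹ • w).im_pos 2),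
    sq_le_sq₀ (δ⁻¹ • w).im_pos.le w.im_pos.le] at hle

theorem IsShortest.upper_of_dist_le (hT : IsShortest G translation w) (hw : 64 ≤ w.im)
    (hδ : δ ∈ G) (hd : dist w (δ • w) ≤ 2) : δ 1 0 = 0 ∧ δ 0 0 = δ 1 1 := by
  have him {ε : SL(2, ℝ)} (hε : ε 1 0 = 0) : (ε • w).im = w.im / ε 1 1 ^ 2 := by
    rw [MulAction.compHom_smul_def, im_smul_eq_div_normSq]
    simp [denom, hε, sq]
  have hw0 := w.im_pos
  have hd' : dist w (δ⁻¹ • w) ≤ 2 := by rwa [← dist_smul δ, smul_inv_smul, dist_comm]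
  obtain ⟨h10, hle⟩ := hT.eq_zero_and_im_le hw hδ hd'
  obtain ⟨h10', hle'⟩ := hT.eq_zero_and_im_le hw (G.inv_mem hδ) (by rwa [inv_inv])
  have hdet : δ 0 0 * δ 1 1 = 1 := by simpa [h10] using det_eq_one δ
  have h00 : 1 ≤ δ 0 0 ^ 2 := by
    have h11' : δ⁻¹ 1 1 = δ 0 0 := by rw [coe_inv]; rfl
    rwa [him h10', h11', div_le_iff₀ (by simp [left_ne_zero_of_mul_eq_one hdet, sq_pos_iff]),
      le_mul_iff_one_le_right hw0] at hle
  have h11 : 1 ≤ δ 1 1 ^ 2 := by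
    rwa [inv_inv, him h10, div_le_iff₀ (by simp [right_ne_zero_of_mul_eq_one hdet, sq_pos_iff]),
      le_mul_iff_one_le_right hw0] at hle'
  have hsub : (δ 0 0 - δ 1 1) ^ 2 ≤ 0 := by
    calc (δ 0 0 - δ 1 1) ^ 2 = -((δ 0 0 ^ 2 - 1) * (δ 1 1 ^ 2 - 1)) := by
          linear_combination (δ 0 0 * δ 1 1 - 1) * hdet
      _ ≤ 0 := by nlinarith
  exact ⟨h10, sub_eq_zero.mp (sq_nonpos_iff _ |>.mp hsub)⟩

theorem card_le_of_one_le_abs_sub {ι : Type*} {s : Finset ι} {f : ι → ℝ} {L : ℝ} (hL0 : 0 ≤ L)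
    (hL : ∀ i ∈ s, |f i| ≤ L) (hsep : ∀ i ∈ s, ∀ j ∈ s, i ≠ j → 1 ≤ |f i - f j|) :
    (s.card : ℝ) ≤ 2 * L + 2 := by
  have hinj : Set.InjOn (fun i ↦ ⌊f i⌋) s := by
    intro i hi j hj hij
    by_contra hne
    exact (hsep i hi j hj hne).not_gt (Int.abs_sub_lt_one_of_floor_eq_floor hij)
  have hmaps : Set.MapsTo (fun i ↦ ⌊f i⌋) s (Finset.Icc ⌊-L⌋ ⌊L⌋) := fun i hi ↦ by
    have := abs_le.mp (hL i hi)
    exact Finset.mem_Icc.mpr ⟨Int.floor_mono this.1, Int.floor_mono this.2⟩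
  have hcard := Finset.card_le_card_of_injOn _ hmaps hinj
  rw [Int.card_Icc] at hcard
  have hfloor : ⌊-L⌋ ≤ ⌊L⌋ := Int.floor_mono (by linarith)
  have hcardR : (s.card : ℝ) ≤ ⌊L⌋ + 1 - ⌊-L⌋ := by
    exact_mod_cast (show (s.card : ℤ) ≤ ⌊L⌋ + 1 - ⌊-L⌋ by omega)
  linarith [Int.floor_le L, Int.lt_floor_add_one (-L)]

theorem abs_le_of_dist_le {g : SL(2, ℝ)} (h10 : g 1 0 = 0) (hdiag : g 0 0 = g 1 1) {R : ℝ}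
    (hR : R ≤ 1) (hd : dist w (g • w) ≤ R) : |g 0 1| ≤ 2 * w.im * R := by
  have := w.im_pos
  have hR0 : 0 ≤ R := dist_nonneg.trans hd
  have hcosh : Real.cosh R ≤ 1 + R ^ 2 := by
    refine (Real.cosh_le_exp_half_sq R).trans ?_
    have hle : |R ^ 2 / 2| ≤ 1 := by
      rw [abs_of_nonneg (by positivity)]
      nlinarith
    have := (abs_le.mp (Real.abs_exp_sub_one_le hle)).2
    rw [abs_of_nonneg (by positivity)] at this
    linarith
  have hdist : Real.cosh (dist w (g • w)) ≤ 1 + R ^ 2 :=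
    (Real.cosh_le_cosh.mpr (abs_le_abs_of_nonneg dist_nonneg hd)).trans hcosh
  have hform : ‖fixedPointForm g w‖ ^ 2 = g 0 1 ^ 2 := by
    simp [fixedPointForm, h10, hdiag]
  rw [cosh_dist_smul, hform, add_le_add_iff_left, div_le_iff₀ (by positivity)] at hdist
  refine abs_le_of_sq_le_sq ?_ (by positivity)
  nlinarith [sq_nonneg (w.im * R)]

theorem IsShortest.card_le (hT : IsShortest G translation w) (hw : 64 ≤ w.im) {R : ℝ} (hR0 : 0 ≤ R)
    (hR : R ≤ 1) {s : Finset SL(2, ℝ)} (hs : ∀ g ∈ s, g ∈ G ∧ dist w (g • w) ≤ R)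
    (hsep : ∀ g ∈ s, ∀ h ∈ s, g ≠ h → g⁻¹ * h ∉ Subgroup.center SL(2, ℝ)) :
    (s.card : ℝ) ≤ 4 * w.im * R + 2 := by
  have := w.im_pos
  have hup : ∀ g ∈ s, g 1 0 = 0 ∧ g 0 0 = g 1 1 := fun g hg ↦
    hT.upper_of_dist_le hw (hs g hg).1 ((hs g hg).2.trans (by linarith))
  have hunit : ∀ g ∈ s, g 0 0 ^ 2 = 1 := fun g hg ↦ by
    have := det_eq_one g
    rw [(hup g hg).1, ← (hup g hg).2] at this
    linarith
  have hcard : (s.card : ℝ) ≤ 2 * (2 * w.im * R) + 2 := by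
    refine card_le_of_one_le_abs_sub (f := fun g : SL(2, ℝ) ↦ g 0 0 * g 0 1) (by positivity)
      (fun g hg ↦ ?_) fun g hg h hh hne ↦ ?_
    · have habs : |g 0 0| = 1 := by rw [← abs_pow_eq_one _ two_ne_zero, hunit g hg, abs_one]
      rw [abs_mul, habs, one_mul]
      exact abs_le_of_dist_le (hup g hg).1 (hup g hg).2 hR (hs g hg).2
    · obtain ⟨h10, hdiag, h01⟩ := inv_mul_of_upper (hup g hg) (hup h hh)
      have hle := hT.le _ (G.mul_mem (G.inv_mem (hs g hg).1) (hs h hh).1) (hsep g hg h hh hne)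
      rw [deviation_translation, deviation_of_upper h10 hdiag, h01,
        div_le_div_iff_of_pos_right (by positivity)] at hle
      rw [← one_le_sq_iff_one_le_abs]
      linear_combination hle + (h 0 1 ^ 2 - g 0 1 ^ 2) * (hunit g hg - hunit h hh)
  linarith

end CuspNeighbourhood

section Unfolding

variable {Γ X : Type*} [Group Γ] [MulAction Γ X]

variable (Γ) in
/-- At most `N` elements of `Γ` move `z` by at most `R`. The bound `N` is real because near a cusp
it is given by a formula. -/
def DisplacementBound [Dist X] (z : X) (R N : ℝ) : Prop :=
  ∀ s : Finset Γ, (∀ γ ∈ s, dist z (γ • z) ≤ R) → (s.card : ℝ) ≤ N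

variable (Γ) in
/-- Every point has at most `N` translates in `B`, counted with multiplicity. -/
def MultiplicityBound (B : Set X) (N : ℝ) : Prop :=
  ∀ (x : X) (s : Finset Γ), (∀ γ ∈ s, γ • x ∈ B) → (s.card : ℝ) ≤ N

variable (Γ) in
/-- The points of `t` are at distance at least `d` from all translates of the other points. -/
def IsOrbitSeparated [Dist X] (d : ℝ) (t : Finset X) : Prop :=
  ∀ x ∈ t, ∀ y ∈ t, ∀ γ : Γ, dist x (γ • y) < d → x = y

theorem DisplacementBound.nonneg [Dist X] {z : X} {R N : ℝ} (h : DisplacementBound Γ z R N) :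
    0 ≤ N := by
  simpa using h ∅

theorem MultiplicityBound.setLIntegral_le [MeasurableSpace X] {μ : Measure X} [Countable Γ]
    [MeasurableConstSMul Γ X] [SMulInvariantMeasure Γ X μ] {F B : Set X} {N : ℝ}
    (hN : MultiplicityBound Γ B N) (hF : IsFundamentalDomain Γ F μ) (hB : MeasurableSet B)
    {φ : X → ENNReal} (hφ : Measurable φ) (hinv : ∀ (γ : Γ) x, φ (γ • x) = φ x) :
    ∫⁻ x in B, φ x ∂μ ≤ ENNReal.ofReal N * ∫⁻ x in F, φ x ∂μ := by
  classical
  have hmeas (γ : Γ) : Measurable fun x ↦ B.indicator φ (γ • x) :=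
    (hφ.indicator hB).comp (measurable_const_smul γ)
  rw [← lintegral_indicator hB, hF.lintegral_eq_tsum'',
    ← lintegral_tsum fun γ ↦ (hmeas γ).aemeasurable, ← lintegral_const_mul _ hφ]
  refine lintegral_mono fun x ↦ ENNReal.summable.tsum_le_of_sum_le fun s ↦ ?_
  calc ∑ γ ∈ s, B.indicator φ (γ • x) = ∑ γ ∈ s with γ • x ∈ B, φ x := by
        simp only [Set.indicator_apply, hinv, Finset.sum_filter]
    _ = ENNReal.ofReal ({γ ∈ s | γ • x ∈ B} : Finset Γ).card * φ x := by
        rw [Finset.sum_const, nsmul_eq_mul, ENNReal.ofReal_natCast]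
    _ ≤ ENNReal.ofReal N * φ x := by
        gcongr
        exact hN x _ fun γ hγ ↦ (Finset.mem_filter.mp hγ).2

section PseudoMetricSpace

variable [PseudoMetricSpace X] [IsIsometricSMul Γ X] {r M : ℝ}

theorem multiplicityBound_of_dist_lt {B : Set X} (hM : 0 ≤ M)
    (hB : ∀ x ∈ B, ∃ w, DisplacementBound Γ w (2 * r) M ∧
      ∀ γ : Γ, γ • x ∈ B → dist x w < r ∧ dist (γ • x) w < r) :
    MultiplicityBound Γ B M := by
  classical
  intro x s hs
  rcases s.eq_empty_or_nonempty with rfl | ⟨γ₀, hγ₀⟩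
  · simpa using hM
  obtain ⟨w, hw, hB⟩ := hB _ (hs γ₀ hγ₀)
  rw [← Finset.card_image_of_injective s (mul_left_injective γ₀⁻¹)]
  refine hw _ (Finset.forall_mem_image.mpr fun γ hγ ↦ ?_)
  obtain ⟨hx, hγx⟩ := hB (γ * γ₀⁻¹) (by simpa [mul_smul] using hs γ hγ)
  rw [← dist_smul (γ * γ₀⁻¹)] at hx
  linarith [dist_triangle_left w ((γ * γ₀⁻¹) • w) ((γ * γ₀⁻¹) • γ₀ • x)]

theorem DisplacementBound.multiplicityBound {B : Set X} {w : X}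
    (h : DisplacementBound Γ w (2 * r) M) (hB : B ⊆ Metric.ball w r) : MultiplicityBound Γ B M :=
  multiplicityBound_of_dist_lt h.nonneg fun _ hx ↦
    ⟨w, h, fun _ hγ ↦ ⟨hB hx, hB hγ⟩⟩

theorem IsOrbitSeparated.multiplicityBound {t : Finset X} (ht : IsOrbitSeparated Γ (2 * r) t)
    (hM : 0 ≤ M) (h : ∀ w ∈ t, DisplacementBound Γ w (2 * r) M) :
    MultiplicityBound Γ (⋃ w ∈ t, Metric.ball w r) M := by
  refine multiplicityBound_of_dist_lt (r := r) hM fun x hx ↦ ?_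
  obtain ⟨w, hw, hxw⟩ := Set.mem_iUnion₂.mp hx
  refine ⟨w, h w hw, fun γ hγ ↦ ⟨hxw, ?_⟩⟩
  obtain ⟨v, hv, hxv⟩ := Set.mem_iUnion₂.mp hγ
  obtain rfl : v = w := by
    refine ht v hv w hw γ ?_
    rw [Metric.mem_ball] at hxw hxv
    rw [← dist_smul γ] at hxw
    linarith [dist_triangle_left v (γ • w) (γ • x)]
  exact hxv

theorem exists_isOrbitSeparated_of_not_covered {W : Set X} {d : ℝ} (hd : 0 < d)
    (hW : ∀ t : Finset X, ∃ w ∈ W, ∀ v ∈ t, ∀ γ : Γ, d ≤ dist v (γ • w)) (n : ℕ) :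
    ∃ t : Finset X, t.card = n ∧ ↑t ⊆ W ∧ IsOrbitSeparated Γ d t := by
  classical
  induction n with
  | zero => exact ⟨∅, rfl, by simp, by simp [IsOrbitSeparated]⟩
  | succ n ih =>
    obtain ⟨t, htn, htW, ht⟩ := ih
    obtain ⟨w, hw, hfar⟩ := hW t
    have hwt : w ∉ t := fun hwt ↦ (hfar w hwt 1).not_gt (by simpa using hd)
    refine ⟨insert w t, by rw [Finset.card_insert_of_notMem hwt, htn], ?_, fun x hx y hy γ hxy ↦ ?_⟩
    · simpa [Set.insert_subset_iff] using ⟨hw, htW⟩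
    · rcases Finset.mem_insert.mp hx with rfl | hxt <;>
        rcases Finset.mem_insert.mp hy with rfl | hyt
      · rfl
      · rw [← dist_smul γ⁻¹, inv_smul_smul, dist_comm] at hxy
        exact absurd hxy (hfar y hyt γ⁻¹).not_gt
      · exact absurd hxy (hfar x hxt γ).not_gt
      · exact ht x hxt y hyt γ hxy

variable [MeasurableSpace X] [OpensMeasurableSpace X] {μ : Measure X} [Countable Γ]
  [MeasurableConstSMul Γ X] [SMulInvariantMeasure Γ X μ] {F : Set X} {v : ENNReal}

theorem IsOrbitSeparated.card_mul_le {t : Finset X} (ht : IsOrbitSeparated Γ (2 * r) t)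
    (hM : 0 ≤ M) (h : ∀ w ∈ t, DisplacementBound Γ w (2 * r) M) (hF : IsFundamentalDomain Γ F μ)
    (hv : ∀ w ∈ t, v ≤ μ (Metric.ball w r)) : t.card * v ≤ ENNReal.ofReal M * μ F := by
  have hdisj : (t : Set X).PairwiseDisjoint fun w ↦ Metric.ball w r := fun x hx y hy hne ↦ by
    refine Metric.ball_disjoint_ball ?_
    contrapose! hne
    refine ht x hx y hy 1 ?_
    rw [one_smul]
    linarith
  calc t.card * v ≤ ∑ w ∈ t, μ (Metric.ball w r) := by
        simpa using Finset.card_nsmul_le_sum t _ v hv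
    _ = ∫⁻ _ in ⋃ w ∈ t, Metric.ball w r, 1 ∂μ := by
        rw [setLIntegral_one, measure_biUnion_finset hdisj fun _ _ ↦ measurableSet_ball]
    _ ≤ ENNReal.ofReal M * ∫⁻ _ in F, 1 ∂μ :=
        (ht.multiplicityBound hM h).setLIntegral_le hF
          (t.measurableSet_biUnion fun _ _ ↦ measurableSet_ball) measurable_const fun _ _ ↦ rfl
    _ = ENNReal.ofReal M * μ F := by rw [setLIntegral_one]

/-- The `r`-balls around an orbit-separated set are disjoint and map to the quotient with bounded
multiplicity, so their number is limited by the volume of the quotient. -/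
theorem exists_finset_forall_exists_dist_lt (hr : 0 < r) (hF : IsFundamentalDomain Γ F μ)
    (hvol : μ F < ⊤) {W : Set X} (h : ∀ w ∈ W, DisplacementBound Γ w (2 * r) M) (hv0 : v ≠ 0)
    (hv : ∀ w ∈ W, v ≤ μ (Metric.ball w r)) :
    ∃ t : Finset X, ∀ w ∈ W, ∃ x ∈ t, ∃ γ : Γ, dist x (γ • w) < 2 * r := by
  by_contra! hcover
  obtain ⟨w, hw, -⟩ := hcover ∅
  have hM : 0 ≤ M := (h w hw).nonneg
  have hle (n : ℕ) : n * v ≤ ENNReal.ofReal M * μ F := by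
    obtain ⟨t, rfl, htW, ht⟩ := exists_isOrbitSeparated_of_not_covered (by positivity) hcover n
    exact ht.card_mul_le hM (fun w hw ↦ h w (htW hw)) hF fun w hw ↦ hv w (htW hw)
  obtain ⟨n, hn⟩ := ENNReal.exists_nat_mul_gt hv0
    (ENNReal.mul_lt_top ENNReal.ofReal_lt_top hvol).ne
  exact (hle n).not_gt hn

end PseudoMetricSpace

end Unfolding

section FuchsianGroups

open scoped Pointwise

variable {Γ : Subgroup PSL(2, ℝ)}

variable (Γ) in
/-- The full preimage of `Γ` in `SL(2, ℝ)`. -/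
def slLift : Subgroup SL(2, ℝ) :=
  Γ.comap (QuotientGroup.mk' (Subgroup.center SL(2, ℝ)))

theorem neg_one_mem_slLift : -1 ∈ slLift Γ := by
  have hcenter : (-1 : SL(2, ℝ)) ∈ Subgroup.center SL(2, ℝ) := by simp [Subgroup.mem_center_iff]
  change (QuotientGroup.mk (-1 : SL(2, ℝ)) : PSL(2, ℝ)) ∈ Γ
  rw [(QuotientGroup.eq_one_iff _).mpr hcenter]
  exact Γ.one_mem

theorem eq_one_of_mem_center {g : SL(2, ℝ)} (hg : g ∈ Subgroup.center SL(2, ℝ))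
    (htrace : 0 < g.val.trace) : g = 1 := by
  obtain ⟨r, hr, hrg⟩ := Matrix.SpecialLinearGroup.mem_center_iff.mp hg
  have hr0 : 0 < r := by simpa [← hrg] using htrace
  obtain rfl : r = 1 := (pow_eq_one_iff_of_nonneg hr0.le (by simp)).mp hr
  exact Subtype.ext (by simp [← hrg])

instance discreteTopology_slLift [DiscreteTopology Γ] : DiscreteTopology (slLift Γ) := by
  refine discreteTopology_of_isOpen_singleton_one ?_
  have hmk : Continuous fun g : slLift Γ ↦ (⟨QuotientGroup.mk g.1, g.2⟩ : Γ) :=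
    (QuotientGroup.continuous_mk.comp continuous_subtype_val).subtype_mk _
  have hval : Continuous fun g : SL(2, ℝ) ↦ g.val := continuous_subtype_val
  have htrace : Continuous fun g : slLift Γ ↦ g.1.val.trace :=
    (hval.comp continuous_subtype_val).matrix_trace
  have heq : {1} = (fun g : slLift Γ ↦ (⟨QuotientGroup.mk g.1, g.2⟩ : Γ)) ⁻¹' {1} ∩
      {g | 0 < g.1.val.trace} := by
    ext ⟨g, hg⟩
    simp only [Set.mem_singleton_iff, Set.mem_inter_iff, Set.mem_preimage, Set.mem_ofPred_eq,
      Subtype.ext_iff, Subgroup.coe_one, QuotientGroup.eq_one_iff]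
    refine ⟨?_, fun h ↦ eq_one_of_mem_center h.1 h.2⟩
    rintro rfl
    exact ⟨Subgroup.one_mem _, by simp⟩
  rw [heq]
  exact ((isOpen_discrete {1}).preimage hmk).inter (isOpen_lt continuous_const htrace)

instance [DiscreteTopology Γ] : Countable Γ := by
  have : SecondCountableTopology (Matrix (Fin 2) (Fin 2) ℝ) :=
    inferInstanceAs (SecondCountableTopology (Fin 2 → Fin 2 → ℝ))
  have : SecondCountableTopology SL(2, ℝ) := TopologicalSpace.Subtype.secondCountableTopology _
  have : Countable (slLift Γ) := countable_of_Lindelof_of_discrete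
  refine Function.Surjective.countable
    (f := fun g : slLift Γ ↦ (⟨QuotientGroup.mk g.1, g.2⟩ : Γ)) ?_
  rintro ⟨γ, hγ⟩
  obtain ⟨g, rfl⟩ := QuotientGroup.mk_surjective γ
  exact ⟨⟨g, hγ⟩, rfl⟩

instance : IsIsometricSMul PSL(2, ℝ) ℍ where
  isometry_smul := QuotientGroup.mk_surjective.forall.mpr fun g ↦ isometry_smul ℍ g

instance : SMulInvariantMeasure PSL(2, ℝ) ℍ volume where
  measure_preimage_smul := QuotientGroup.mk_surjective.forall.mpr fun g _ hs ↦
    SMulInvariantMeasure.measure_preimage_smul (g : GL (Fin 2) ℝ) hs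

instance : IsIsometricSMul Γ ℍ where
  isometry_smul γ := isometry_smul ℍ γ.1

instance : Measure.IsOpenPosMeasure (volume : Measure ℍ) where
  open_pos U hU hne := by
    have hU' := isOpenEmbedding_coe.isOpenMap _ hU
    have him : Function.support (fun z : ℂ ↦ (((1 / ‖z.im‖₊) ^ 2 : NNReal) : ENNReal)) ∩
        (↑) '' U = (↑) '' U := Set.inter_eq_right.mpr <| by
      rintro _ ⟨z, -, rfl⟩
      simp [z.im_ne_zero]
    rw [volume_eq_lintegral, ← pos_iff_ne_zero, setLIntegral_pos_iff (by fun_prop), him]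
    exact hU'.measure_pos _ (hne.image _)

theorem volume_ball_eq (z w : ℍ) (r : ℝ) :
    volume (Metric.ball z r) = volume (Metric.ball w r) := by
  obtain ⟨g, rfl⟩ := MulAction.exists_smul_eq SL(2, ℝ) w z
  have hball : Metric.ball (g • w) r = (g : PSL(2, ℝ)) • Metric.ball w r :=
    (Metric.smul_ball (g : PSL(2, ℝ)) w r).symm
  rw [hball, measure_smul]

theorem displacementBound_of_forall_card_le {z : ℍ} {R N : ℝ}
    (h : ∀ s : Finset SL(2, ℝ), (∀ g ∈ s, g ∈ slLift Γ ∧ dist z (g • z) ≤ R) →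
      (∀ g ∈ s, ∀ h ∈ s, g ≠ h → g⁻¹ * h ∉ Subgroup.center SL(2, ℝ)) → (s.card : ℝ) ≤ N) :
    DisplacementBound Γ z R N := by
  classical
  intro s hs
  let lift (γ : Γ) : SL(2, ℝ) := Quotient.out γ.1
  have hlift (γ : Γ) : QuotientGroup.mk (lift γ) = γ.1 := Quotient.out_eq' γ.1
  have hinj : Function.Injective lift := fun γ δ hγδ ↦
    Subtype.ext (by rw [← hlift γ, hγδ, hlift δ])
  rw [← Finset.card_image_of_injective s hinj]
  refine h _ (Finset.forall_mem_image.mpr fun γ hγ ↦ ⟨?_, ?_⟩)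
    (Finset.forall_mem_image.mpr fun γ _ ↦ Finset.forall_mem_image.mpr fun δ _ hne hc ↦ ?_)
  · have hmem : QuotientGroup.mk (lift γ) ∈ Γ := hlift γ ▸ γ.2
    exact hmem
  · have hsmul : γ • z = (QuotientGroup.mk (lift γ) : PSL(2, ℝ)) • z := by rw [hlift]; rfl
    exact hsmul ▸ hs γ hγ
  · rw [← QuotientGroup.eq, hlift, hlift] at hc
    exact hne (congrArg lift (Subtype.ext hc))

theorem exists_displacementBound_of_thickPart {c : ℝ} (hc : 0 < c) (R : ℝ) :
    ∃ M : ℝ, ∀ w ∈ thickPart (slLift Γ) c, DisplacementBound Γ w R M := by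
  obtain ⟨M, hM⟩ := exists_card_le_of_separated hc R
  refine ⟨M, fun w hw ↦ displacementBound_of_forall_card_le fun s hs hsep ↦ ?_⟩
  refine Nat.cast_le.mpr (hM w s (fun g hg ↦ (hs g hg).2) fun g hg h hh hne ↦ hw _ ?_ ?_)
  · exact mul_mem (inv_mem (hs g hg).1) (hs h hh).1
  · exact hsep g hg h hh hne

theorem exists_displacementBound_of_isCompact [DiscreteTopology Γ] {K : Set ℍ} (hK : IsCompact K)
    (R : ℝ) : ∃ M : ℝ, ∀ w ∈ K, DisplacementBound Γ w R M := by
  have hfin := finite_dist_le (G := slLift Γ) hK R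
  refine ⟨hfin.toFinset.card, fun w hw ↦ displacementBound_of_forall_card_le fun s hs _ ↦ ?_⟩
  refine Nat.cast_le.mpr (Finset.card_le_card fun g hg ↦ hfin.mem_toFinset.mpr ?_)
  exact ⟨(hs g hg).1, w, hw, (hs g hg).2⟩

theorem IsShortest.displacementBound {σ : SL(2, ℝ)} {w : ℍ}
    (hσ : IsShortest (slLift Γ) (σ * translation * σ⁻¹) (σ • w)) (hw : 64 ≤ w.im) {R : ℝ}
    (hR0 : 0 ≤ R) (hR : R ≤ 1) : DisplacementBound Γ (σ • w) R (4 * w.im * R + 2) := by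
  classical
  have hT := hσ.conj_smul σ⁻¹
  rw [inv_smul_smul, show σ⁻¹ * (σ * translation * σ⁻¹) * σ⁻¹⁻¹ = translation by group] at hT
  refine displacementBound_of_forall_card_le fun s hs hsep ↦ ?_
  rw [← Finset.card_image_of_injective s (MulAut.conj σ⁻¹).injective]
  refine hT.card_le hw hR0 hR (Finset.forall_mem_image.mpr fun g hg ↦ ⟨?_, ?_⟩)
    (Finset.forall_mem_image.mpr fun g hg ↦ Finset.forall_mem_image.mpr fun h hh hne ↦ ?_)
  · exact Subgroup.smul_mem_pointwise_smul g (MulAut.conj σ⁻¹) _ (hs g hg).1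
  · rw [← dist_smul σ]
    simpa [mul_smul] using (hs g hg).2
  · rw [← map_inv, ← map_mul, MulAut.conj_apply]
    simpa using (conj_mem_center_iff (h := σ)).not.mpr (hsep g hg h hh fun hgh ↦ hne (by rw [hgh]))

theorem IsCofiniteFuchsian.exists_isCompact_of_thickPart (hΓ : IsCofiniteFuchsian Γ) {c : ℝ}
    (hc : 0 < c) :
    ∃ K : Set ℍ, IsCompact K ∧ ∀ w ∈ thickPart (slLift Γ) c, ∃ h ∈ slLift Γ, h • w ∈ K := by
  obtain ⟨F, hF, hvol⟩ := hΓ.finite_area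
  have := hΓ.discrete
  obtain ⟨M, hM⟩ := exists_displacementBound_of_thickPart (Γ := Γ) hc (2 * 1)
  obtain ⟨t, ht⟩ := exists_finset_forall_exists_dist_lt one_pos hF hvol hM
    (Metric.measure_ball_pos volume I one_pos).ne' fun w _ ↦ (volume_ball_eq I w 1).le
  refine ⟨⋃ x ∈ t, Metric.closedBall x (2 * 1),
    t.finite_toSet.isCompact_biUnion fun x _ ↦ isCompact_closedBall _ _, fun w hw ↦ ?_⟩
  obtain ⟨x, hx, ⟨γ, hγ⟩, hdist⟩ := ht w hw
  obtain ⟨g, rfl⟩ := QuotientGroup.mk_surjective γ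
  exact ⟨g, hγ, Set.mem_iUnion₂.mpr ⟨x, hx, Metric.mem_closedBall'.mpr hdist.le⟩⟩

theorem IsCofiniteFuchsian.exists_cusp_decomposition (hΓ : IsCofiniteFuchsian Γ) :
    ∃ (K : Set ℍ) (S : Set SL(2, ℝ)), IsCompact K ∧ S.Finite ∧ ∀ z, ∃ h ∈ slLift Γ, h • z ∈ K ∨
      ∃ σ ∈ S, ∃ w : ℍ, h • z = σ • w ∧ 64 ≤ w.im ∧
        IsShortest (slLift Γ) (σ * translation * σ⁻¹) (σ • w) := by
  have := hΓ.discrete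
  obtain ⟨K, P, hK, hP, htrace, hdecomp⟩ := exists_compact_and_parabolics (G := slLift Γ)
    (fun c hc ↦ hΓ.exists_isCompact_of_thickPart hc) (c := 1 / 64 ^ 2) (by norm_num) (by norm_num)
  have hcusp (g : SL(2, ℝ)) : ∃ σ : SL(2, ℝ), ∀ z, g ∈ P → IsShortest (slLift Γ) g z →
      IsShortest (slLift Γ) (σ * translation * σ⁻¹) z ∧
        deviation g z = 1 / (σ⁻¹ • z).im ^ 2 := by
    by_cases hg : g ∈ P ∧ g ∈ slLift Γ ∧ g ∉ Subgroup.center SL(2, ℝ)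
    · obtain ⟨σ, hσ, hdev⟩ :=
        exists_conj_translation_mem neg_one_mem_slLift hg.2.1 hg.2.2 (htrace g hg.1)
      refine ⟨σ, fun z _ hz ↦ ⟨⟨hσ, ?_, fun h hh hc ↦ (hdev z).trans_le (hz.le h hh hc)⟩, ?_⟩⟩
      · rw [← deviation_eq_zero_iff (z := z), hdev, deviation_eq_zero_iff]
        exact hz.notMem_center
      · rw [← hdev, deviation_conj_translation]
    · exact ⟨1, fun z hgP hz ↦ (hg ⟨hgP, hz.mem, hz.notMem_center⟩).elim⟩
  choose σ hσ using hcusp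
  refine ⟨K, σ '' P, hK, hP.image σ, fun z ↦ ?_⟩
  obtain ⟨h, hh, hz | ⟨g, hg, hshort, hdev⟩⟩ := hdecomp z
  · exact ⟨h, hh, Or.inl hz⟩
  · obtain ⟨hT, him⟩ := hσ g (h • z) hg hshort
    refine ⟨h, hh, Or.inr ⟨σ g, ⟨g, hg, rfl⟩, (σ g)⁻¹ • h • z, (smul_inv_smul _ _).symm, ?_, ?_⟩⟩
    · have hpos := ((σ g)⁻¹ • h • z).im_pos
      rw [him, one_div_lt_one_div (pow_pos hpos 2) (by norm_num)] at hdev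
      exact (lt_of_pow_lt_pow_left₀ 2 hpos.le hdev).le
    · rwa [smul_inv_smul]

end FuchsianGroups

section SubMeanValue

variable {E : Type*} [NormedAddCommGroup E] [NormedSpace ℂ E] [CompleteSpace E] {g : ℂ → E} {c : ℂ}
  {r R : ℝ}

theorem enorm_le_lintegral_circle (hr : 0 ≤ r)
    (hg : DifferentiableOn ℂ g (Metric.closedBall c r)) :
    ∫⁻ _ in Set.Ioo (-Real.pi) Real.pi, ‖g c‖ₑ ≤
      ∫⁻ θ in Set.Ioo (-Real.pi) Real.pi, ‖g (circleMap c r θ)‖ₑ := by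
  have hmean : (2 * Real.pi) • g c = ∫ θ in Set.Ioo (-Real.pi) Real.pi, g (circleMap c r θ) := by
    have hcl : DiffContOnCl ℂ g (Metric.ball c |r|) := by
      rw [← abs_of_nonneg hr] at hg
      exact hg.diffContOnCl_ball subset_rfl
    rw [← hcl.circleAverage, Real.circleAverage_eq_integral_add (-Real.pi),
      intervalIntegral.integral_comp_add_right (fun θ ↦ g (circleMap c r θ)), zero_add,
      smul_inv_smul₀ Real.two_pi_pos.ne', two_mul, add_neg_cancel_right,
      intervalIntegral.integral_of_le (by linarith [Real.pi_pos]), integral_Ioc_eq_integral_Ioo]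
  calc ∫⁻ _ in Set.Ioo (-Real.pi) Real.pi, ‖g c‖ₑ = ‖(2 * Real.pi) • g c‖ₑ := by
        rw [setLIntegral_const, Real.volume_Ioo, enorm_smul, sub_neg_eq_add, ← two_mul, mul_comm,
          Real.enorm_of_nonneg Real.two_pi_pos.le]
    _ ≤ _ := hmean ▸ enorm_integral_le_lintegral_enorm _

theorem lintegral_ball_eq_lintegral_circleMap {φ : ℂ → ENNReal}
    (hφ : Measurable ((Metric.ball c R).indicator φ)) :
    ∫⁻ z in Metric.ball c R, φ z = ∫⁻ r in Set.Ioo 0 R,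
      ENNReal.ofReal r * ∫⁻ θ in Set.Ioo (-Real.pi) Real.pi, φ (circleMap c r θ) := by
  have hpolar (p : ℝ × ℝ) : c + Complex.polarCoord.symm p = circleMap c p.1 p.2 := by
    rw [Complex.polarCoord_symm_apply, circleMap, Complex.exp_mul_I]
    simp
  have : Measurable fun p : ℝ × ℝ ↦ (Metric.ball c R).indicator φ (circleMap c p.1 p.2) :=
    hφ.comp (by unfold circleMap; fun_prop)
  have hind {r θ : ℝ} (hr : 0 < r) : (Metric.ball c R).indicator φ (circleMap c r θ) =
      (Set.Iio R).indicator (fun r ↦ φ (circleMap c r θ)) r := by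
    have hmem : circleMap c r θ ∈ Metric.ball c R ↔ r < R := by
      rw [mem_ball_iff_norm, circleMap_sub_center, norm_circleMap_zero, abs_of_pos hr]
    by_cases hrR : r < R
    · rw [Set.indicator_of_mem (hmem.mpr hrR), Set.indicator_of_mem (Set.mem_Iio.mpr hrR)]
    · rw [Set.indicator_of_notMem (mt hmem.mp hrR), Set.indicator_of_notMem (mt Set.mem_Iio.mp hrR)]
  rw [← lintegral_indicator measurableSet_ball, ← lintegral_add_left_eq_self _ c,
    ← Complex.lintegral_comp_polarCoord_symm, polarCoord_target, Measure.volume_eq_prod,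
    ← Measure.prod_restrict]
  simp only [hpolar, smul_eq_mul]
  have hIoo : Set.Ioo 0 R = Set.Iio R ∩ Set.Ioi 0 := by rw [Set.inter_comm, Set.Ioi_inter_Iio]
  rw [lintegral_prod _ (by fun_prop), hIoo, ← setLIntegral_indicator measurableSet_Iio]
  refine setLIntegral_congr_fun measurableSet_Ioi fun r hr ↦ ?_
  simp only [hind hr]
  rw [lintegral_const_mul' _ _ ENNReal.ofReal_ne_top]
  by_cases hrR : r < R <;> simp [hrR]

theorem enorm_mul_volume_ball_le_lintegral (hg : DifferentiableOn ℂ g (Metric.ball c R)) :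
    ‖g c‖ₑ * volume (Metric.ball c R) ≤ ∫⁻ z in Metric.ball c R, ‖g z‖ₑ := by
  have hmeas : Measurable ((Metric.ball c R).indicator fun z ↦ ‖g z‖ₑ) := by
    classical
    rw [← Set.piecewise_eq_indicator]
    exact hg.continuousOn.enorm.measurable_piecewise continuousOn_const measurableSet_ball
  rw [← setLIntegral_const, lintegral_ball_eq_lintegral_circleMap hmeas,
    lintegral_ball_eq_lintegral_circleMap (measurable_const.indicator measurableSet_ball)]
  refine setLIntegral_mono' measurableSet_Ioo fun r hr ↦ ?_
  gcongr ENNReal.ofReal r * ?_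
  exact enorm_le_lintegral_circle hr.1.le (hg.mono (Metric.closedBall_subset_ball hr.2))

end SubMeanValue

section WeightedMeanValue

variable {k : ℕ} {t : ℝ}

theorem exp_sub_two_mul_sq_le (ht : |t| ≤ 1 / 5) : Real.exp (t - 2 * t ^ 2) ≤ 1 + t := by
  obtain ⟨hl, hu⟩ := abs_le.mp ht
  have habs : |t - 2 * t ^ 2| ≤ 1 := abs_le.mpr ⟨by nlinarith, by nlinarith⟩
  have hexp := (abs_le.mp (Real.abs_exp_sub_one_sub_id_le habs)).2
  nlinarith [mul_nonneg (sq_nonneg t) (show 0 ≤ 1 + 4 * t - 4 * t ^ 2 by nlinarith)]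

theorem exp_div_two_le_pow_div_sq (hk : 1 ≤ k) (ht : t ^ 2 ≤ 1 / (25 * k)) :
    Real.exp (2 * k * t) / 2 ≤ (1 + t) ^ (2 * k) / (1 + t) ^ 2 := by
  have hk' : (1 : ℝ) ≤ k := by exact_mod_cast hk
  have habs : |t| ≤ 1 / 5 := by
    refine abs_le_of_sq_le_sq (ht.trans ?_) (by norm_num)
    rw [div_le_iff₀ (by positivity)]
    linarith
  obtain ⟨hl, hu⟩ := abs_le.mp habs
  have hexp : Real.exp (2 * k * t) * Real.exp (-(4 / 25)) ≤ (1 + t) ^ (2 * k) := by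
    calc Real.exp (2 * k * t) * Real.exp (-(4 / 25)) = Real.exp (2 * k * t + -(4 / 25)) :=
          (Real.exp_add _ _).symm
      _ ≤ Real.exp ((2 * k : ℕ) * (t - 2 * t ^ 2)) := by
          rw [le_div_iff₀ (by positivity)] at ht
          push_cast
          exact Real.exp_le_exp.mpr (by linarith)
      _ = Real.exp (t - 2 * t ^ 2) ^ (2 * k) := Real.exp_nat_mul _ _
      _ ≤ (1 + t) ^ (2 * k) := by
          gcongr
          exact exp_sub_two_mul_sq_le habs
  have hconst : (1 : ℝ) - 4 / 25 ≤ Real.exp (-(4 / 25)) := by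
    linarith [Real.add_one_le_exp (-(4 / 25) : ℝ)]
  rw [le_div_iff₀ (by nlinarith)]
  calc Real.exp (2 * k * t) / 2 * (1 + t) ^ 2 ≤ Real.exp (2 * k * t) / 2 * (36 / 25) := by
        gcongr
        nlinarith
    _ ≤ Real.exp (2 * k * t) * Real.exp (-(4 / 25)) := by
        nlinarith [Real.exp_pos (2 * k * t)]
    _ ≤ (1 + t) ^ (2 * k) := hexp

theorem sq_im_sub_div_le {z ζ : ℂ} (hz : 0 < z.im)
    (hζ : ζ ∈ Metric.ball z (z.im / (5 * √k))) : ((ζ.im - z.im) / z.im) ^ 2 ≤ 1 / (25 * k) := by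
  have him : |ζ.im - z.im| ≤ z.im / (5 * √k) := by
    rw [← Complex.sub_im]
    exact (Complex.abs_im_le_norm _).trans (mem_ball_iff_norm.mp hζ).le
  calc ((ζ.im - z.im) / z.im) ^ 2 = |ζ.im - z.im| ^ 2 / z.im ^ 2 := by rw [sq_abs, div_pow]
    _ ≤ (z.im / (5 * √k)) ^ 2 / z.im ^ 2 := by gcongr
    _ = 1 / (25 * k) := by
      rw [div_pow, mul_pow, Real.sq_sqrt k.cast_nonneg]
      field_simp
      norm_num

theorem im_pos_of_mem_ball (hk : 1 ≤ k) {z ζ : ℂ} (hz : 0 < z.im)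
    (hζ : ζ ∈ Metric.ball z (z.im / (5 * √k))) : 0 < ζ.im := by
  have hsqrt : 1 ≤ √(k : ℝ) := Real.one_le_sqrt.mpr (by exact_mod_cast hk)
  have hρ : z.im / (5 * √k) ≤ z.im := div_le_self hz.le (by linarith)
  have him : |ζ.im - z.im| < z.im / (5 * √k) := by
    rw [← Complex.sub_im]
    exact (Complex.abs_im_le_norm _).trans_lt (mem_ball_iff_norm.mp hζ)
  linarith [(abs_lt.mp him).1]

theorem enorm_twist_le (hk : 1 ≤ k) {z ζ a : ℂ} (hz : 0 < z.im)
    (hζ : ζ ∈ Metric.ball z (z.im / (5 * √k))) :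
    ENNReal.ofReal (z.im ^ (2 * k) / (2 * z.im ^ 2)) *
        ‖a ^ 2 * Complex.exp (-(2 * Complex.I * (k / z.im : ℝ)) * (ζ - z))‖ₑ ≤
      ENNReal.ofReal (1 / ζ.im ^ 2) * ENNReal.ofReal (‖a‖ ^ 2 * ζ.im ^ (2 * k)) := by
  have hζ0 := im_pos_of_mem_ball hk hz hζ
  rw [← ofReal_norm, ← ENNReal.ofReal_mul (by positivity), ← ENNReal.ofReal_mul (by positivity)]
  refine ENNReal.ofReal_le_ofReal ?_
  have hmain := exp_div_two_le_pow_div_sq hk (sq_im_sub_div_le hz hζ)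
  have hre : (-(2 * Complex.I * (k / z.im : ℝ)) * (ζ - z)).re =
      2 * k * ((ζ.im - z.im) / z.im) := by
    simp
    ring
  have him : ζ.im = z.im * (1 + (ζ.im - z.im) / z.im) := by field_simp; ring
  rw [norm_mul, norm_pow, Complex.norm_exp, hre]
  generalize (ζ.im - z.im) / z.im = t at hmain him
  calc z.im ^ (2 * k) / (2 * z.im ^ 2) * (‖a‖ ^ 2 * Real.exp (2 * k * t))
      = z.im ^ (2 * k) / z.im ^ 2 * ‖a‖ ^ 2 * (Real.exp (2 * k * t) / 2) := by field_simp
    _ ≤ z.im ^ (2 * k) / z.im ^ 2 * ‖a‖ ^ 2 * ((1 + t) ^ (2 * k) / (1 + t) ^ 2) := by gcongr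
    _ = 1 / ζ.im ^ 2 * (‖a‖ ^ 2 * ζ.im ^ (2 * k)) := by
      rw [him, mul_pow, mul_pow]
      field_simp

/-- On a disc of hyperbolic radius about `k ^ (-1/2)` the weight `y ^ (2k)` is comparable to the
squared absolute value of an exponential, so it can be absorbed into the holomorphic function before
the sub-mean value inequality is applied. -/
theorem sq_norm_mul_im_pow_le_lintegral (hk : 1 ≤ k) {f : ℂ → ℂ} {z : ℂ} (hz : 0 < z.im)
    (hf : DifferentiableOn ℂ f (Metric.ball z (z.im / (5 * √k)))) :
    ENNReal.ofReal (‖f z‖ ^ 2 * z.im ^ (2 * k)) ≤ ENNReal.ofReal (25 * k) *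
      ∫⁻ ζ in Metric.ball z (z.im / (5 * √k)),
        ENNReal.ofReal (1 / ζ.im ^ 2) * ENNReal.ofReal (‖f ζ‖ ^ 2 * ζ.im ^ (2 * k)) := by
  have : (0 : ℝ) < k := by exact_mod_cast hk
  let h (ζ : ℂ) : ℂ := f ζ ^ 2 * Complex.exp (-(2 * Complex.I * (k / z.im : ℝ)) * (ζ - z))
  have hh : DifferentiableOn ℂ h (Metric.ball z (z.im / (5 * √k))) := (hf.pow 2).mul (by fun_prop)
  have hhz : ‖h z‖ₑ = ENNReal.ofReal (‖f z‖ ^ 2) := by simp [h, ← ofReal_norm]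
  have hvol : volume (Metric.ball z (z.im / (5 * √k))) =
      ENNReal.ofReal (z.im ^ 2 / (25 * k) * Real.pi) := by
    rw [Complex.volume_ball, ← ENNReal.ofReal_pow (by positivity), ← ENNReal.ofReal_coe_nnreal,
      ← ENNReal.ofReal_mul (by positivity), div_pow, mul_pow, Real.sq_sqrt k.cast_nonneg]
    norm_num
  calc ENNReal.ofReal (‖f z‖ ^ 2 * z.im ^ (2 * k))
      ≤ ENNReal.ofReal (25 * k * (z.im ^ (2 * k) / (2 * z.im ^ 2) *
          (‖f z‖ ^ 2 * (z.im ^ 2 / (25 * k) * Real.pi)))) := by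
        refine ENNReal.ofReal_le_ofReal ?_
        have hpi : 1 ≤ Real.pi / 2 := by linarith [Real.two_le_pi]
        calc ‖f z‖ ^ 2 * z.im ^ (2 * k) ≤ ‖f z‖ ^ 2 * z.im ^ (2 * k) * (Real.pi / 2) :=
              le_mul_of_one_le_right (by positivity) hpi
          _ = _ := by field_simp
    _ = ENNReal.ofReal (25 * k) * (ENNReal.ofReal (z.im ^ (2 * k) / (2 * z.im ^ 2)) *
          (‖h z‖ₑ * volume (Metric.ball z (z.im / (5 * √k))))) := by
        rw [hhz, hvol, ← ENNReal.ofReal_mul (by positivity), ← ENNReal.ofReal_mul (by positivity),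
          ← ENNReal.ofReal_mul (by positivity)]
    _ ≤ ENNReal.ofReal (25 * k) * (ENNReal.ofReal (z.im ^ (2 * k) / (2 * z.im ^ 2)) *
          ∫⁻ ζ in Metric.ball z (z.im / (5 * √k)), ‖h ζ‖ₑ) := by
        gcongr
        exact enorm_mul_volume_ball_le_lintegral hh
    _ ≤ _ := by
        rw [← lintegral_const_mul' _ _ ENNReal.ofReal_ne_top]
        gcongr ENNReal.ofReal (25 * k) * ?_
        exact setLIntegral_mono' measurableSet_ball fun ζ hζ ↦ enorm_twist_le hk hz hζ

end WeightedMeanValue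

section Density

theorem setLIntegral_eq_setLIntegral_image {φ : ℍ → ENNReal} (hφ : Measurable φ) {S : Set ℍ}
    (hS : MeasurableSet S) : ∫⁻ z in S, φ z =
      ∫⁻ ζ in UpperHalfPlane.coe '' S, ENNReal.ofReal (1 / ζ.im ^ 2) * φ (ofComplex ζ) := by
  have hmp : MeasurePreserving UpperHalfPlane.coe (volume.comap UpperHalfPlane.coe)
      (volume.restrict (.range UpperHalfPlane.coe)) :=
    ⟨measurable_coe, by rw [measurableEmbedding_coe.map_comap]⟩
  have : Measurable fun z : ℍ ↦ NNReal.mk z.im z.im_pos.le :=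
    (continuous_im.subtype_mk _).measurable
  rw [volume_def, setLIntegral_withDensity_eq_setLIntegral_mul _ (by fun_prop) hφ hS,
    ← Measure.restrict_restrict_of_subset (Set.image_subset_range _ _),
    ← hmp.setLIntegral_comp_emb measurableEmbedding_coe]
  refine setLIntegral_congr_fun hS fun z _ ↦ ?_
  rw [Pi.mul_apply, ofComplex_apply, ← ENNReal.ofReal_coe_nnreal]
  simp

/-- The function `|f z| ^ 2 * y ^ (2k)`, which is `Γ`-invariant if `f` has weight `2k` for `Γ`. -/
def density (k : ℕ) (f : ℍ → ℂ) (z : ℍ) : ℝ := ‖f z‖ ^ 2 * z.im ^ (2 * k)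

variable {Γ : Subgroup PSL(2, ℝ)} {k : ℕ} {f : ℍ → ℂ}

theorem density_nonneg (z : ℍ) : 0 ≤ density k f z :=
  mul_nonneg (sq_nonneg _) (pow_nonneg z.im_pos.le _)

theorem density_eq_sq (z : ℍ) : density k f z = (‖f z‖ * z.im ^ k) ^ 2 := by
  rw [density, mul_pow, ← pow_mul, mul_comm 2]

theorem continuous_density (hf : Continuous f) : Continuous (density k f) :=
  (hf.norm.pow 2).mul (continuous_im.pow _)

theorem density_slash (σ : SL(2, ℝ)) (z : ℍ) :
    density k (SlashAction.map (2 * (k : ℤ)) (σ : GL (Fin 2) ℝ) f) z = density k f (σ • z) := by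
  have hpetersson (g : ℍ → ℂ) (w : ℍ) : density k g w = ‖petersson (2 * (k : ℤ)) g g w‖ := by
    rw [density, petersson, norm_mul, norm_mul, norm_zpow, Complex.norm_conj, Complex.norm_real,
      Real.norm_of_nonneg w.im_pos.le, sq]
    norm_cast
  rw [hpetersson, hpetersson, petersson_slash]
  simp
  rfl

theorem density_smul_of_mem_slLift (f : CuspForms Γ k) {g : SL(2, ℝ)} (hg : g ∈ slLift Γ) (z : ℍ) :
    density k f (g • z) = density k f z := by
  have hmem : (g : GL (Fin 2) ℝ) ∈ matrixLift Γ := ⟨g, hg, rfl⟩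
  rw [← density_slash, SlashInvariantFormClass.slash_action_eq f _ hmem]

theorem density_smul (f : CuspForms Γ k) (γ : Γ) (z : ℍ) : density k f (γ • z) = density k f z := by
  obtain ⟨⟨g⟩, hg⟩ := γ
  exact density_smul_of_mem_slLift f hg z

theorem density_le_setLIntegral (hk : 1 ≤ k) (hf : MDiff f) (z : ℍ) :
    ENNReal.ofReal (density k f z) ≤ ENNReal.ofReal (25 * k) *
      ∫⁻ w in UpperHalfPlane.coe ⁻¹' Metric.ball (z : ℂ) (z.im / (5 * √k)),
        ENNReal.ofReal (density k f w) := by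
  have himage : UpperHalfPlane.coe '' (UpperHalfPlane.coe ⁻¹'
      Metric.ball (z : ℂ) (z.im / (5 * √k))) = Metric.ball (z : ℂ) (z.im / (5 * √k)) :=
    Set.image_preimage_eq_of_subset fun ζ hζ ↦ ⟨⟨ζ, im_pos_of_mem_ball hk z.im_pos hζ⟩, rfl⟩
  rw [setLIntegral_eq_setLIntegral_image
    (continuous_density hf.continuous).measurable.ennreal_ofReal
    (measurableSet_ball.preimage measurable_coe), himage]
  have hlocal := sq_norm_mul_im_pow_le_lintegral hk (f := f ∘ ofComplex) z.im_pos
    ((UpperHalfPlane.mdifferentiable_iff.mp hf).mono fun _ ↦ im_pos_of_mem_ball hk z.im_pos)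
  rw [Function.comp_apply, ofComplex_apply] at hlocal
  refine hlocal.trans_eq ?_
  congr 1
  refine setLIntegral_congr_fun measurableSet_ball fun ζ hζ ↦ ?_
  have hζ0 := im_pos_of_mem_ball hk z.im_pos hζ
  simp only [density, Function.comp_apply, ofComplex_apply_of_im_pos hζ0]
  rfl

theorem dist_lt_of_coe_mem_ball (hk : 1 ≤ k) {w z : ℍ}
    (hw : (w : ℂ) ∈ Metric.ball (z : ℂ) (z.im / (5 * √k))) : dist w z < 1 / (2 * √k) := by
  have hsqrt : 1 ≤ √(k : ℝ) := Real.one_le_sqrt.mpr (by exact_mod_cast hk)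
  have hy := z.im_pos
  have hwz : dist (w : ℂ) z < z.im / (5 * √k) := hw
  have him : z.im * (4 / 5) ≤ w.im := by
    have hle : z.im / (5 * √k) ≤ z.im / 5 := by
      gcongr
      linarith
    have habs : |w.im - z.im| ≤ dist (w : ℂ) z := by
      simpa [dist_eq_norm] using Complex.abs_im_le_norm ((w : ℂ) - z)
    linarith [(abs_le.mp habs).1]
  have hgeom : z.im * (4 / 5) ≤ √(w.im * z.im) := Real.le_sqrt_of_sq_le (by nlinarith)
  calc dist w z ≤ dist (w : ℂ) z / √(w.im * z.im) := dist_le_dist_coe_div_sqrt w z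
    _ ≤ dist (w : ℂ) z / (z.im * (4 / 5)) := by gcongr
    _ < z.im / (5 * √k) / (z.im * (4 / 5)) := by gcongr
    _ ≤ 1 / (2 * √k) := by
      field_simp
      norm_num

theorem density_le_of_displacementBound [Countable Γ] {F : Set ℍ} (hF : IsFundamentalDomain Γ F)
    (hk : 1 ≤ k) (f : CuspForms Γ k) {z : ℍ} {N : ℝ} (hN : DisplacementBound Γ z (1 / √k) N) :
    ENNReal.ofReal (density k f z) ≤
      ENNReal.ofReal (25 * k * N) * ∫⁻ w in F, ENNReal.ofReal (density k f w) := by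
  have hB : MultiplicityBound Γ
      (UpperHalfPlane.coe ⁻¹' Metric.ball (z : ℂ) (z.im / (5 * √k))) N := by
    refine DisplacementBound.multiplicityBound (w := z) (r := 1 / (2 * √k)) ?_
      fun w ↦ dist_lt_of_coe_mem_ball hk
    rwa [← mul_div_assoc, mul_one, mul_comm 2, div_mul_cancel_right₀ two_ne_zero, ← one_div]
  have hholo : MDiff f := CuspFormClass.holo f
  calc ENNReal.ofReal (density k f z)
      ≤ ENNReal.ofReal (25 * k) * ∫⁻ w in UpperHalfPlane.coe ⁻¹'
          Metric.ball (z : ℂ) (z.im / (5 * √k)), ENNReal.ofReal (density k f w) :=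
        density_le_setLIntegral hk hholo z
    _ ≤ ENNReal.ofReal (25 * k) *
          (ENNReal.ofReal N * ∫⁻ w in F, ENNReal.ofReal (density k f w)) := by
        gcongr ENNReal.ofReal (25 * k) * ?_
        exact hB.setLIntegral_le hF (measurableSet_ball.preimage measurable_coe)
          (continuous_density hholo.continuous).measurable.ennreal_ofReal
          fun γ w ↦ by rw [density_smul]
    _ = _ := by rw [ENNReal.ofReal_mul (p := 25 * k) (by positivity), mul_assoc]

end Density

section CuspExpansion

open scoped Nat

theorem pow_mul_exp_neg_le {k : ℕ} {y₀ y : ℝ} (hy₀ : 0 < y₀) (hk : k ≤ y₀) (hy : y₀ ≤ y) :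
    y ^ k * Real.exp (-(y - y₀)) ≤ y₀ ^ k := by
  have hratio : y / y₀ = (y - y₀) / y₀ + 1 := by field_simp; ring
  have hpow : (y / y₀) ^ k ≤ Real.exp (y - y₀) := by
    calc (y / y₀) ^ k ≤ Real.exp ((y - y₀) / y₀) ^ k := by
          rw [hratio]
          gcongr
          exact Real.add_one_le_exp _
      _ = Real.exp (k * ((y - y₀) / y₀)) := (Real.exp_nat_mul _ _).symm
      _ ≤ Real.exp (y - y₀) := by
          rw [Real.exp_le_exp, mul_div_left_comm]
          exact mul_le_of_le_one_right (sub_nonneg.mpr hy) ((div_le_one hy₀).mpr hk)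
  rw [div_pow, div_le_iff₀ (by positivity)] at hpow
  rwa [Real.exp_neg, ← div_eq_mul_inv, div_le_iff₀ (Real.exp_pos _), mul_comm]

variable {𝒢 : Subgroup (GL (Fin 2) ℝ)} {κ : ℤ} {F : Type*} [FunLike F ℍ ℂ] [CuspFormClass F 𝒢 κ]
  (f : F) {y₀ : ℝ}

include 𝒢 κ

theorem norm_le_mul_exp_of_mem_strictPeriods {h : ℝ} (hh : 0 < h) (hper : h ∈ 𝒢.strictPeriods)
    (hy₀ : 0 < y₀) {A : ℝ} (hA : ∀ z : ℍ, z.im = y₀ → ‖f z‖ ≤ A) {z : ℍ} (hz : y₀ ≤ z.im) :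
    ‖f z‖ ≤ A * Real.exp (-2 * Real.pi * (z.im - y₀) / h) := by
  set G := cuspFunction h f
  set R := Real.exp (-2 * Real.pi * y₀ / h) with hR
  have hG0 : G 0 = 0 := CuspFormClass.cuspFunction_apply_zero f hh hper
  have hGq (w : ℍ) : G (Function.Periodic.qParam h w) = f w :=
    SlashInvariantFormClass.eq_cuspFunction f w hper hh.ne'
  have hR1 : R < 1 :=
    Real.exp_lt_one_iff.mpr (div_neg_of_neg_of_pos (by nlinarith [Real.pi_pos]) hh)
  have hsphere (q : ℂ) (hq : ‖q‖ = R) : ‖G q‖ ≤ A := by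
    have hq0 : q ≠ 0 := norm_pos_iff.mp (hq ▸ Real.exp_pos _)
    have him : (Function.Periodic.invQParam h q).im = y₀ := by
      rw [Function.Periodic.im_invQParam, hq, hR, Real.log_exp]
      field_simp
    rw [← Function.Periodic.qParam_right_inv hh.ne' hq0]
    exact (hGq ⟨_, him ▸ hy₀⟩).symm ▸ hA _ him
  have hdiff : DifferentiableOn ℂ G (Metric.closedBall 0 R) := fun q hq ↦
    (ModularFormClass.differentiableAt_cuspFunction f hh hper
      ((mem_closedBall_zero_iff.mp hq).trans_lt hR1)).differentiableWithinAt
  have hball : Set.MapsTo G (Metric.ball 0 R) (Metric.closedBall (G 0) A) := fun q hq ↦ by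
    rw [hG0, mem_closedBall_zero_iff]
    refine Complex.norm_le_of_forall_mem_frontier_norm_le Metric.isBounded_ball
      (hdiff.diffContOnCl_ball subset_rfl) (fun p hp ↦ ?_) (subset_closure hq)
    rw [frontier_ball _ (Real.exp_pos _).ne', mem_sphere_zero_iff_norm] at hp
    exact hsphere p hp
  have hnorm : ‖Function.Periodic.qParam h z‖ = R * Real.exp (-2 * Real.pi * (z.im - y₀) / h) := by
    rw [Function.Periodic.norm_qParam, hR, ← Real.exp_add, coe_im]
    ring_nf
  rcases hz.eq_or_lt with heq | hlt
  · simpa [heq] using hA z heq.symm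
  have hq : Function.Periodic.qParam h z ∈ Metric.ball 0 R := by
    rw [mem_ball_zero_iff, hnorm]
    refine mul_lt_of_lt_one_right (Real.exp_pos _) (Real.exp_lt_one_iff.mpr ?_)
    exact div_neg_of_neg_of_pos (by nlinarith [Real.pi_pos]) hh
  have hschwarz := Complex.dist_le_div_mul_dist_of_mapsTo_ball
    (hdiff.mono Metric.ball_subset_closedBall) hball hq
  rwa [hG0, dist_zero_right, dist_zero_right, hGq, hnorm, ← mul_assoc,
    div_mul_cancel₀ _ (Real.exp_pos _).ne'] at hschwarz

theorem exists_norm_le_of_mem_strictPeriods {h : ℝ} (hh : 0 < h) (hper : h ∈ 𝒢.strictPeriods)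
    (hy₀ : 0 < y₀) : ∃ A : ℝ, ∀ z : ℍ, z.im = y₀ → ‖f z‖ ≤ A := by
  have hline (x : ℝ) : ((x : ℂ) + y₀ * Complex.I) ∈ {z : ℂ | 0 < z.im} := by simpa
  have hcont : Continuous fun x : ℝ ↦ (f ∘ ofComplex) (x + y₀ * Complex.I) :=
    (UpperHalfPlane.mdifferentiable_iff.mp (ModularFormClass.holo f)).continuousOn.comp_continuous
      (by fun_prop) hline
  have hperiodic : Function.Periodic (fun x : ℝ ↦ (f ∘ ofComplex) (x + y₀ * Complex.I)) h :=
    fun x ↦ by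
      dsimp only
      rw [← SlashInvariantFormClass.periodic_comp_ofComplex f hper (x + y₀ * Complex.I)]
      push_cast
      ring_nf
  obtain ⟨A, hA⟩ := (hperiodic.isBounded_of_continuous hh.ne' hcont).exists_norm_le
  refine ⟨A, fun z hz ↦ ?_⟩
  have hzeq : (z : ℂ) = z.re + y₀ * Complex.I := by rw [← hz]; exact (Complex.re_add_im _).symm
  simpa [← hzeq] using hA _ (Set.mem_range_self z.re)

variable {k : ℕ}

theorem density_le_of_le_im (hper : 1 ∈ 𝒢.strictPeriods) (hy₀ : 0 < y₀) (hk : k ≤ y₀) {B : ℝ}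
    (hB : ∀ z : ℍ, z.im = y₀ → density k f z ≤ B) {z : ℍ} (hz : y₀ ≤ z.im) :
    density k f z ≤ B := by
  have hA (w : ℍ) (hw : w.im = y₀) : ‖f w‖ ≤ √B / y₀ ^ k := by
    rw [le_div_iff₀ (by positivity)]
    refine Real.le_sqrt_of_sq_le (le_of_eq_of_le ?_ (hB w hw))
    rw [density_eq_sq, hw]
  have hB0 : 0 ≤ B := (density_nonneg ⟨⟨0, y₀⟩, hy₀⟩).trans (hB _ rfl)
  have hexp : Real.exp (-2 * Real.pi * (z.im - y₀) / 1) ≤ Real.exp (-(z.im - y₀)) := by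
    gcongr
    nlinarith [Real.two_le_pi]
  rw [density_eq_sq, ← Real.sq_sqrt hB0]
  have := z.im_pos
  refine pow_le_pow_left₀ (by positivity) ?_ 2
  calc ‖f z‖ * z.im ^ k ≤ √B / y₀ ^ k * Real.exp (-(z.im - y₀)) * z.im ^ k := by
        gcongr
        exact (norm_le_mul_exp_of_mem_strictPeriods f one_pos hper hy₀ hA hz).trans (by gcongr)
    _ = √B / y₀ ^ k * (z.im ^ k * Real.exp (-(z.im - y₀))) := by ring
    _ ≤ √B / y₀ ^ k * y₀ ^ k := by
        gcongr
        exact pow_mul_exp_neg_le hy₀ hk hz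
    _ = √B := by field_simp

theorem exists_density_le_of_mem_strictPeriods (hper : 1 ∈ 𝒢.strictPeriods) (hy₀ : 0 < y₀) :
    ∃ B : ℝ, ∀ z : ℍ, y₀ ≤ z.im → density k f z ≤ B := by
  obtain ⟨A, hA⟩ := exists_norm_le_of_mem_strictPeriods f one_pos hper hy₀
  have hA0 : 0 ≤ A := (norm_nonneg _).trans (hA ⟨⟨0, y₀⟩, hy₀⟩ rfl)
  refine ⟨(A * (k ! * Real.exp y₀)) ^ 2, fun z hz ↦ ?_⟩
  have hpow : z.im ^ k ≤ k ! * Real.exp z.im := by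
    rw [← div_le_iff₀' (by positivity)]
    exact Real.pow_div_factorial_le_exp _ z.im_pos.le _
  rw [density_eq_sq]
  have := z.im_pos
  refine pow_le_pow_left₀ (by positivity) ?_ 2
  calc ‖f z‖ * z.im ^ k
      ≤ A * Real.exp (-2 * Real.pi * (z.im - y₀) / 1) * (k ! * Real.exp z.im) := by
        gcongr
        exact norm_le_mul_exp_of_mem_strictPeriods f one_pos hper hy₀ hA hz
    _ = A * (k ! * Real.exp (-2 * Real.pi * (z.im - y₀) / 1 + z.im)) := by
        rw [Real.exp_add]
        ring
    _ ≤ A * (k ! * Real.exp y₀) := by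
        gcongr
        nlinarith [Real.two_le_pi]

end CuspExpansion

section SupNorm

open ConjAct
open scoped Pointwise

variable {Γ : Subgroup PSL(2, ℝ)} {k : ℕ} {F : Set ℍ} {σ : SL(2, ℝ)}

theorem one_mem_strictPeriods_conj (hσ : σ * translation * σ⁻¹ ∈ slLift Γ) :
    (1 : ℝ) ∈ (toConjAct (σ : GL (Fin 2) ℝ)⁻¹ • matrixLift Γ).strictPeriods := by
  have htranslation : Matrix.GeneralLinearGroup.upperRightHom (1 : ℝ) =
      (translation : GL (Fin 2) ℝ) := by
    refine Units.ext ?_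
    change _ = translation.val
    rw [coe_translation]
    rfl
  rw [Subgroup.mem_strictPeriods_iff, htranslation, map_inv, Subgroup.mem_inv_pointwise_smul_iff,
    toConjAct_smul]
  exact ⟨_, hσ, by simp only [map_mul, map_inv]⟩

theorem density_translate (f : CuspForms Γ k) (z : ℍ) :
    density k (CuspForm.translate f (σ : GL (Fin 2) ℝ)) z = density k f (σ • z) :=
  density_slash σ z

theorem density_smul_le_of_le_im (f : CuspForms Γ k) (hσ : σ * translation * σ⁻¹ ∈ slLift Γ)
    {y₀ : ℝ} (hy₀ : 0 < y₀) (hk : k ≤ y₀) {B : ℝ}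
    (hB : ∀ w : ℍ, w.im = y₀ → density k f (σ • w) ≤ B) {w : ℍ} (hw : y₀ ≤ w.im) :
    density k f (σ • w) ≤ B := by
  simp only [← density_translate] at hB ⊢
  exact density_le_of_le_im _ (one_mem_strictPeriods_conj hσ) hy₀ hk hB hw

theorem exists_density_smul_le (f : CuspForms Γ k) (hσ : σ * translation * σ⁻¹ ∈ slLift Γ)
    {y₀ : ℝ} (hy₀ : 0 < y₀) : ∃ B : ℝ, ∀ w : ℍ, y₀ ≤ w.im → density k f (σ • w) ≤ B := by
  simp only [← density_translate]
  exact exists_density_le_of_mem_strictPeriods _ (one_mem_strictPeriods_conj hσ) hy₀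

theorem IsCofiniteFuchsian.exists_density_le (hΓ : IsCofiniteFuchsian Γ) (f : CuspForms Γ k) :
    ∃ B, ∀ z, density k f z ≤ B := by
  obtain ⟨K, S, hK, hS, hdecomp⟩ := hΓ.exists_cusp_decomposition
  obtain ⟨B₁, hB₁⟩ := hK.bddAbove_image
    (continuous_density (k := k) (CuspFormClass.holo f).continuous).continuousOn
  have hcusp (σ : SL(2, ℝ)) : ∃ B, σ * translation * σ⁻¹ ∈ slLift Γ →
      ∀ w : ℍ, 64 ≤ w.im → density k f (σ • w) ≤ B := by
    by_cases hσ : σ * translation * σ⁻¹ ∈ slLift Γ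
    · obtain ⟨B, hB⟩ := exists_density_smul_le f hσ (y₀ := 64) (by norm_num)
      exact ⟨B, fun _ ↦ hB⟩
    · exact ⟨0, fun h ↦ (hσ h).elim⟩
  choose B hB using hcusp
  obtain ⟨B₂, hB₂⟩ := (hS.image B).bddAbove
  refine ⟨max B₁ B₂, fun z ↦ ?_⟩
  obtain ⟨h, hh, hz | ⟨σ, hσ, w, hw, him, hshort⟩⟩ := hdecomp z
  · rw [← density_smul_of_mem_slLift f hh]
    exact le_max_of_le_left (hB₁ ⟨_, hz, rfl⟩)
  · rw [← density_smul_of_mem_slLift f hh, hw]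
    exact le_max_of_le_right ((hB σ hshort.mem w him).trans (hB₂ ⟨σ, hσ, rfl⟩))

theorem IsCofiniteFuchsian.volume_lt_top (hΓ : IsCofiniteFuchsian Γ)
    (hF : IsFundamentalDomain Γ F (volume : Measure ℍ)) : volume F < ⊤ := by
  have := hΓ.discrete
  obtain ⟨F₀, hF₀, hvol⟩ := hΓ.finite_area
  rwa [hF.measure_eq hF₀]

theorem IsCofiniteFuchsian.integrableOn_density (hΓ : IsCofiniteFuchsian Γ)
    (hF : IsFundamentalDomain Γ F (volume : Measure ℍ)) (f : CuspForms Γ k) :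
    IntegrableOn (density k f) F volume := by
  obtain ⟨B, hB⟩ := hΓ.exists_density_le f
  refine Measure.integrableOn_of_bounded (M := B) (hΓ.volume_lt_top hF).ne
    (continuous_density (CuspFormClass.holo f).continuous).aestronglyMeasurable
    (Filter.Eventually.of_forall fun z ↦ ?_)
  rw [Real.norm_of_nonneg (density_nonneg z)]
  exact hB z

theorem IsCofiniteFuchsian.density_le_mul_integral (hΓ : IsCofiniteFuchsian Γ)
    (hF : IsFundamentalDomain Γ F (volume : Measure ℍ)) (hk : 1 ≤ k) (f : CuspForms Γ k)
    {z : ℍ} {N : ℝ} (hN : DisplacementBound Γ z (1 / √k) N) :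
    density k f z ≤ 25 * k * N * ∫ w in F, density k f w := by
  have := hΓ.discrete
  have h := density_le_of_displacementBound hF hk f hN
  have hN0 := hN.nonneg
  have hI : 0 ≤ ∫ w in F, density k f w := integral_nonneg density_nonneg
  rw [← ofReal_integral_eq_lintegral_ofReal (hΓ.integrableOn_density hF f)
    (Filter.Eventually.of_forall density_nonneg), ← ENNReal.ofReal_mul (by positivity)] at h
  exact (ENNReal.ofReal_le_ofReal_iff (by positivity)).mp h

theorem IsShortest.of_conj_translation {G : Subgroup SL(2, ℝ)} [DiscreteTopology G] {w v : ℍ}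
    (hσ : IsShortest G (σ * translation * σ⁻¹) (σ • w)) (hv : 8 ≤ v.im) :
    IsShortest G (σ * translation * σ⁻¹) (σ • v) := by
  refine hσ.of_deviation_le ?_
  rw [deviation_conj_translation, inv_smul_smul]
  exact one_div_le_one_div_of_le (by norm_num) (by nlinarith)

theorem IsShortest.density_le_of_im_le (hΓ : IsCofiniteFuchsian Γ)
    (hF : IsFundamentalDomain Γ F (volume : Measure ℍ)) (hk : 1 ≤ k) (f : CuspForms Γ k) {w : ℍ}
    (hσ : IsShortest (slLift Γ) (σ * translation * σ⁻¹) (σ • w)) (hw : 64 ≤ w.im)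
    (hwk : w.im ≤ 64 * k) :
    density k f (σ • w) ≤ 6450 * (k * √k) * ∫ v in F, density k f v := by
  have hsqrt : 1 ≤ √(k : ℝ) := Real.one_le_sqrt.mpr (by exact_mod_cast hk)
  have hI : 0 ≤ ∫ v in F, density k f v := integral_nonneg density_nonneg
  have hN := hσ.displacementBound hw (by positivity) ((div_le_one (by positivity)).mpr hsqrt)
  refine (hΓ.density_le_mul_integral hF hk f hN).trans (mul_le_mul_of_nonneg_right ?_ hI)
  calc 25 * (k : ℝ) * (4 * w.im * (1 / √k) + 2)
      ≤ 25 * k * (4 * (64 * k) * (1 / √k) + 2 * √k) := by gcongr; linarith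
    _ = 25 * k * (256 * (k / √k) + 2 * √k) := by ring
    _ = 6450 * (k * √k) := by rw [Real.div_sqrt]; ring

theorem IsShortest.density_le (hΓ : IsCofiniteFuchsian Γ)
    (hF : IsFundamentalDomain Γ F (volume : Measure ℍ)) (hk : 1 ≤ k) (f : CuspForms Γ k) {w : ℍ}
    (hσ : IsShortest (slLift Γ) (σ * translation * σ⁻¹) (σ • w)) (hw : 64 ≤ w.im) :
    density k f (σ • w) ≤ 6450 * (k * √k) * ∫ v in F, density k f v := by
  have := hΓ.discrete
  have hk' : (1 : ℝ) ≤ k := by exact_mod_cast hk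
  obtain hwk | hwk := le_total w.im (64 * k)
  · exact hσ.density_le_of_im_le hΓ hF hk f hw hwk
  · refine density_smul_le_of_le_im f hσ.mem (by positivity) (by linarith) (fun v hv ↦ ?_) hwk
    exact (hσ.of_conj_translation (by linarith)).density_le_of_im_le hΓ hF hk f (by linarith) hv.le

theorem IsCofiniteFuchsian.exists_sup_norm_le (hΓ : IsCofiniteFuchsian Γ) :
    ∃ C : ℝ, 0 < C ∧ ∀ k : ℕ, 1 ≤ k → ∀ F : Set ℍ,
      IsFundamentalDomain Γ F (volume : Measure ℍ) → ∀ (f : CuspForms Γ k) (z : ℍ),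
        density k f z ≤ C * (k : ℝ) ^ (3 / 2 : ℝ) * ∫ w in F, density k f w := by
  have := hΓ.discrete
  obtain ⟨K, S, hK, -, hdecomp⟩ := hΓ.exists_cusp_decomposition
  obtain ⟨M, hM⟩ := exists_displacementBound_of_isCompact (Γ := Γ) hK 1
  refine ⟨max (25 * M) 6450, lt_max_of_lt_right (by norm_num), fun k hk F hF f z ↦ ?_⟩
  have hsqrt : 1 ≤ √(k : ℝ) := Real.one_le_sqrt.mpr (by exact_mod_cast hk)
  have hpow : (k : ℝ) ^ (3 / 2 : ℝ) = k * √k := by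
    rw [Real.sqrt_eq_rpow, ← Real.rpow_one_add' (by positivity) (by norm_num)]
    norm_num
  have hI : 0 ≤ ∫ w in F, density k f w := integral_nonneg density_nonneg
  rw [hpow]
  obtain ⟨h, hh, hz | ⟨σ, -, w, hw, him, hσ⟩⟩ := hdecomp z
  · have hN : DisplacementBound Γ (h • z) (1 / √k) M := fun s hs ↦
      hM _ hz s fun γ hγ ↦ (hs γ hγ).trans ((div_le_one (by positivity)).mpr hsqrt)
    have := hN.nonneg
    calc density k f z = density k f (h • z) := (density_smul_of_mem_slLift f hh z).symm
      _ ≤ 25 * k * M * ∫ w in F, density k f w := hΓ.density_le_mul_integral hF hk f hN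
      _ = 25 * M * (k * 1) * ∫ w in F, density k f w := by ring
      _ ≤ max (25 * M) 6450 * (k * √k) * ∫ w in F, density k f w := by
          gcongr
          exact le_max_left _ _
  · rw [← density_smul_of_mem_slLift f hh, hw]
    refine (hσ.density_le hΓ hF hk f him).trans ?_
    gcongr
    exact le_max_right _ _

end SupNorm

section OrthonormalFamilies

variable {𝕜 V : Type*} [RCLike 𝕜] [NormedAddCommGroup V] [InnerProductSpace 𝕜 V]

theorem sum_sq_norm_le_of_orthonormal {ι : Type*} [Fintype ι] {e : ι → V}
    (he : Orthonormal 𝕜 e) (L : V →ₗ[𝕜] 𝕜) {A : ℝ} (hA : 0 ≤ A)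
    (hL : ∀ v, ‖L v‖ ^ 2 ≤ A * ‖v‖ ^ 2) : ∑ i, ‖L (e i)‖ ^ 2 ≤ A := by
  set s := ∑ i, ‖L (e i)‖ ^ 2
  -- the extremal vector: it represents `L` on the span of the family
  set v := ∑ i, starRingEnd 𝕜 (L (e i)) • e i
  have hLv : L v = (s : 𝕜) := by
    simp only [v, s, map_sum, map_smul, smul_eq_mul, RCLike.conj_mul,
      RCLike.ofReal_pow]
  have hv : ‖v‖ ^ 2 = s := by
    rw [← RCLike.ofReal_inj (K := 𝕜), RCLike.ofReal_pow, ← inner_self_eq_norm_sq_to_K,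
      he.inner_sum]
    simp only [s, RCLike.conj_conj, RCLike.mul_conj, RCLike.ofReal_sum, RCLike.ofReal_pow]
  have hs : 0 ≤ s := by positivity
  have hsq : s * s ≤ A * s := by
    simpa only [hLv, hv, RCLike.norm_ofReal, abs_of_nonneg hs, sq] using hL v
  rcases hs.eq_or_lt with h | h
  · exact h ▸ hA
  · exact le_of_mul_le_mul_right hsq h

theorem finiteDimensional_of_orthonormal_card_le {N : ℕ}
    (h : ∀ (n : ℕ) (e : Fin n → V), Orthonormal 𝕜 e → n ≤ N) : FiniteDimensional 𝕜 V := by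
  rw [FiniteDimensional, ← Module.rank_lt_aleph0_iff]
  refine (rank_le (n := N) fun s hs ↦ ?_).trans_lt Cardinal.natCast_lt_aleph0
  rw [← finrank_span_finset_eq_card hs]
  exact h _ _ ((stdOrthonormalBasis 𝕜
    (Submodule.span 𝕜 (s : Set V))).orthonormal.comp_linearIsometry (Submodule.subtypeₗᵢ _))

end OrthonormalFamilies

section Petersson

open ComplexConjugate

variable {Γ : Subgroup PSL(2, ℝ)} {k : ℕ} {F : Set ℍ}

theorem norm_mul_conj_mul_pow_le (a b : ℂ) (z : ℍ) : ‖a * conj b * (z.im : ℂ) ^ (2 * k)‖ ≤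
    ‖a‖ ^ 2 * z.im ^ (2 * k) + ‖b‖ ^ 2 * z.im ^ (2 * k) := by
  rw [norm_mul, norm_mul, RCLike.norm_conj, norm_pow, Complex.norm_real,
    Real.norm_of_nonneg z.im_pos.le, ← add_mul]
  have := z.im_pos
  gcongr
  nlinarith [two_mul_le_add_sq ‖a‖ ‖b‖, mul_nonneg (norm_nonneg a) (norm_nonneg b)]

theorem IsCofiniteFuchsian.integrableOn_petersson (hΓ : IsCofiniteFuchsian Γ)
    (hF : IsFundamentalDomain Γ F (volume : Measure ℍ)) (f g : CuspForms Γ k) :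
    IntegrableOn (fun z : ℍ ↦ f z * conj (g z) * (z.im : ℂ) ^ (2 * k)) F volume := by
  have hf : Continuous f := (CuspFormClass.holo f).continuous
  have hg : Continuous g := (CuspFormClass.holo g).continuous
  have hcont : Continuous fun z : ℍ ↦ f z * conj (g z) * (z.im : ℂ) ^ (2 * k) := by fun_prop
  exact ((hΓ.integrableOn_density hF f).add (hΓ.integrableOn_density hF g)).mono'
    hcont.aestronglyMeasurable
    (Filter.Eventually.of_forall fun z ↦ norm_mul_conj_mul_pow_le (f z) (g z) z)

theorem peterssonInner_self (f : CuspForms Γ k) :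
    peterssonInner F f f = ((∫ z in F, density k f z : ℝ) : ℂ) := by
  rw [peterssonInner, ← integral_complex_ofReal]
  refine integral_congr_ae (Filter.Eventually.of_forall fun z ↦ ?_)
  simp only [Complex.mul_conj', density, Complex.ofReal_mul, Complex.ofReal_pow]

theorem conj_peterssonInner (f g : CuspForms Γ k) :
    conj (peterssonInner F f g) = peterssonInner F g f := by
  rw [peterssonInner, peterssonInner, ← integral_conj]
  refine integral_congr_ae (Filter.Eventually.of_forall fun z ↦ ?_)
  simp only [map_mul, map_pow, Complex.conj_conj, Complex.conj_ofReal, mul_comm (conj (f z))]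

theorem IsCofiniteFuchsian.peterssonInner_add_right (hΓ : IsCofiniteFuchsian Γ)
    (hF : IsFundamentalDomain Γ F (volume : Measure ℍ)) (f g h : CuspForms Γ k) :
    peterssonInner F f (g + h) = peterssonInner F f g + peterssonInner F f h := by
  rw [peterssonInner, peterssonInner, peterssonInner,
    ← integral_add (hΓ.integrableOn_petersson hF f g) (hΓ.integrableOn_petersson hF f h)]
  simp only [add_apply, map_add, mul_add, add_mul]

theorem peterssonInner_smul_right (f g : CuspForms Γ k) (c : ℂ) :
    peterssonInner F f (c • g) = conj c * peterssonInner F f g := by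
  rw [peterssonInner, peterssonInner, ← integral_const_mul]
  refine integral_congr_ae (Filter.Eventually.of_forall fun z ↦ ?_)
  simp only [smul_apply, smul_eq_mul, map_mul]
  ring

theorem IsCofiniteFuchsian.eq_zero_of_integral_density_eq_zero (hΓ : IsCofiniteFuchsian Γ)
    (hk : 1 ≤ k) (hF : IsFundamentalDomain Γ F (volume : Measure ℍ)) {f : CuspForms Γ k}
    (hf : ∫ z in F, density k f z = 0) : f = 0 := by
  obtain ⟨C, -, hC⟩ := hΓ.exists_sup_norm_le
  refine CuspForm.ext fun z ↦ ?_
  have hz : density k f z = 0 :=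
    le_antisymm (by simpa only [hf, mul_zero] using hC k hk F hF f z) (density_nonneg z)
  simpa [density, z.im_ne_zero] using hz

/-- The Petersson inner product, with the argument order of Mathlib (conjugate-linear in the first
variable). -/
@[reducible] def peterssonCore (hΓ : IsCofiniteFuchsian Γ) (hk : 1 ≤ k)
    (hF : IsFundamentalDomain Γ F (volume : Measure ℍ)) :
    InnerProductSpace.Core ℂ (CuspForms Γ k) where
  inner f g := peterssonInner F g f
  conj_inner_symm f g := conj_peterssonInner f g
  re_inner_nonneg f := by
    rw [peterssonInner_self]
    exact integral_nonneg density_nonneg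
  add_left f g h := hΓ.peterssonInner_add_right hF h f g
  smul_left f g c := peterssonInner_smul_right g f c
  definite f hf := by
    rw [peterssonInner_self] at hf
    exact hΓ.eq_zero_of_integral_density_eq_zero hk hF (by exact_mod_cast hf)

/-- The Petersson norm on cusp forms, used as a local instance. -/
@[reducible] def peterssonNormedAddCommGroup (hΓ : IsCofiniteFuchsian Γ) (hk : 1 ≤ k)
    (hF : IsFundamentalDomain Γ F (volume : Measure ℍ)) : NormedAddCommGroup (CuspForms Γ k) :=
  (peterssonCore hΓ hk hF).toNormedAddCommGroup

/-- The space of cusp forms as an inner product space, used as a local instance. -/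
@[reducible] def peterssonInnerProductSpace (hΓ : IsCofiniteFuchsian Γ) (hk : 1 ≤ k)
    (hF : IsFundamentalDomain Γ F (volume : Measure ℍ)) :
    letI := peterssonNormedAddCommGroup hΓ hk hF
    InnerProductSpace ℂ (CuspForms Γ k) :=
  letI := peterssonNormedAddCommGroup hΓ hk hF
  InnerProductSpace.ofCore (peterssonCore hΓ hk hF).toCore

theorem isPeterssonOrthonormal_iff (hΓ : IsCofiniteFuchsian Γ) (hk : 1 ≤ k)
    (hF : IsFundamentalDomain Γ F (volume : Measure ℍ)) {ι : Type} [DecidableEq ι]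
    {e : ι → CuspForms Γ k} :
    letI := peterssonNormedAddCommGroup hΓ hk hF
    letI := peterssonInnerProductSpace hΓ hk hF
    IsPeterssonOrthonormal F e ↔ Orthonormal ℂ e := by
  let := peterssonNormedAddCommGroup hΓ hk hF
  let := peterssonInnerProductSpace hΓ hk hF
  rw [orthonormal_iff_ite, IsPeterssonOrthonormal, forall_comm]
  refine forall₂_congr fun i j ↦ ?_
  simp only [eq_comm (a := j)]
  rfl

/-- The linear functional `f ↦ f z * y ^ k`, whose squared absolute value is the density. -/
def weightedEval (z : ℍ) : CuspForms Γ k →ₗ[ℂ] ℂ where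
  toFun f := f z * (z.im : ℂ) ^ k
  map_add' f g := by rw [add_apply, add_mul]
  map_smul' c f := by rw [smul_apply, smul_eq_mul, smul_eq_mul, mul_assoc]; rfl

theorem sq_norm_weightedEval (f : CuspForms Γ k) (z : ℍ) :
    ‖weightedEval z f‖ ^ 2 = density k f z := by
  rw [density_eq_sq, weightedEval, LinearMap.coe_mk, AddHom.coe_mk, norm_mul, norm_pow,
    Complex.norm_real, Real.norm_of_nonneg z.im_pos.le]

section DensityBound

variable {A : ℝ} (hΓ : IsCofiniteFuchsian Γ) (hk : 1 ≤ k)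
  (hF : IsFundamentalDomain Γ F (volume : Measure ℍ)) (hA : 0 ≤ A)
  (hbound : ∀ (f : CuspForms Γ k) (z : ℍ), density k f z ≤ A * ∫ w in F, density k f w)

include hΓ hk hF hA hbound

theorem sumSq_le_of_density_le {ι : Type} [Fintype ι] [DecidableEq ι]
    {e : ι → CuspForms Γ k} (he : IsPeterssonOrthonormal F e) (z : ℍ) : sumSq e z ≤ A := by
  let := peterssonNormedAddCommGroup hΓ hk hF
  let := peterssonInnerProductSpace hΓ hk hF
  have hnorm (f : CuspForms Γ k) : ‖f‖ ^ 2 = ∫ w in F, density k f w := by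
    rw [← Complex.ofReal_inj, ← peterssonInner_self, Complex.ofReal_pow]
    exact (inner_self_eq_norm_sq_to_K (𝕜 := ℂ) f).symm
  calc sumSq e z = ∑ j, ‖weightedEval z (e j)‖ ^ 2 := by
        simp only [sq_norm_weightedEval, sumSq, density]
    _ ≤ A := sum_sq_norm_le_of_orthonormal ((isPeterssonOrthonormal_iff hΓ hk hF).mp he) _ hA
        fun f ↦ by rw [sq_norm_weightedEval, hnorm]; exact hbound f z

theorem card_le_of_density_le {ι : Type} [Fintype ι] [DecidableEq ι]
    {e : ι → CuspForms Γ k} (he : IsPeterssonOrthonormal F e) :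
    (Fintype.card ι : ℝ) ≤ A * volume.real F := by
  have hunit (j : ι) : ∫ z in F, density k (e j) z = 1 := by
    simpa only [peterssonInner_self, if_true, Complex.ofReal_eq_one] using he j j
  have hint (j : ι) := hΓ.integrableOn_density hF (e j)
  calc (Fintype.card ι : ℝ) = ∑ j, ∫ z in F, density k (e j) z := by simp [hunit]
    _ = ∫ z in F, sumSq e z := (integral_finsetSum _ fun j _ ↦ hint j).symm
    _ ≤ ∫ _ in F, A := integral_mono (integrable_finsetSum _ fun j _ ↦ hint j)
        (integrableOn_const (hΓ.volume_lt_top hF).ne) (sumSq_le_of_density_le hΓ hk hF hA hbound he)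
    _ = A * volume.real F := by rw [setIntegral_const, smul_eq_mul, mul_comm]

theorem finite_of_density_le : Module.Finite ℂ (CuspForms Γ k) := by
  let := peterssonNormedAddCommGroup hΓ hk hF
  let := peterssonInnerProductSpace hΓ hk hF
  refine finiteDimensional_of_orthonormal_card_le (𝕜 := ℂ) (N := ⌊A * volume.real F⌋₊)
    fun n e he ↦ Nat.le_floor ?_
  simpa only [Fintype.card_fin] using
    card_le_of_density_le hΓ hk hF hA hbound ((isPeterssonOrthonormal_iff hΓ hk hF).mpr he)

end DensityBound

theorem exists_isPeterssonOrthonormal_basis (hΓ : IsCofiniteFuchsian Γ) (hk : 1 ≤ k)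
    (hF : IsFundamentalDomain Γ F (volume : Measure ℍ)) [Module.Finite ℂ (CuspForms Γ k)] :
    ∃ f : Module.Basis (Fin (Module.finrank ℂ (CuspForms Γ k))) ℂ (CuspForms Γ k),
      IsPeterssonOrthonormal F f := by
  let := peterssonNormedAddCommGroup hΓ hk hF
  let := peterssonInnerProductSpace hΓ hk hF
  have hb := (stdOrthonormalBasis ℂ (CuspForms Γ k)).orthonormal
  rw [← OrthonormalBasis.coe_toBasis] at hb
  exact ⟨_, (isPeterssonOrthonormal_iff hΓ hk hF).mpr hb⟩

end Petersson

end

end FuchsianCusp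

theorem theorem5p2 (Γ : Subgroup PSL(2, ℝ)) (hΓ : FuchsianCusp.IsCofiniteFuchsian Γ) :
    ∃ C : ℝ, 0 < C ∧ ∀ k : ℕ, 1 ≤ k →
      ∀ F : Set ℍ, IsFundamentalDomain Γ F (volume : Measure ℍ) →
        (∃ f : Module.Basis (Fin (Module.finrank ℂ (FuchsianCusp.CuspForms Γ k))) ℂ
            (FuchsianCusp.CuspForms Γ k), FuchsianCusp.IsPeterssonOrthonormal F f) ∧
        ∀ f : Module.Basis (Fin (Module.finrank ℂ (FuchsianCusp.CuspForms Γ k))) ℂ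
            (FuchsianCusp.CuspForms Γ k), FuchsianCusp.IsPeterssonOrthonormal F f →
          ∀ z : ℍ, FuchsianCusp.sumSq f z ≤ C * (k : ℝ) ^ (3 / 2 : ℝ) := by
  obtain ⟨C, hC, hbound⟩ := hΓ.exists_sup_norm_le
  refine ⟨C, hC, fun k hk F hF ↦ ?_⟩
  have hA : 0 ≤ C * (k : ℝ) ^ (3 / 2 : ℝ) := by positivity
  have := FuchsianCusp.finite_of_density_le hΓ hk hF hA (hbound k hk F hF)
  exact ⟨FuchsianCusp.exists_isPeterssonOrthonormal_basis hΓ hk hF, fun f hf z ↦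
    FuchsianCusp.sumSq_le_of_density_le hΓ hk hF hA (hbound k hk F hF) hf z⟩
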